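/- Let $\mathcal D(n,p)$ denote the random digraph on the vertex set $[n]$ in which each of the $n(n-1)$ arcs $\overrightarrow{uv}$, $u\neq v$, is present independently with probability $p$. A Hamilton cycle of a digraph is a directed cycle passing through every vertex exactly once. Let $p=p(n)\in[0,1]$ satisfy $p=\omega\!\left(\frac{\log^4 n}{n}\right)$, i.e. $\frac{\log^4 n}{n\,p(n)}\to 0$ as $n\to\infty$. Then there is a sequence $\varepsilon_n\to 0$ such that, with probability tending to $1$ as $n\to\infty$, the digraph $D\sim\mathcal D(n,p)$ contains at least $(1-\varepsilon_n)np$ pairwise arc-disjoint directed Hamilton cycles. -/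

import Mathlib

namespace Digraph

/-- The set of arcs of a digraph, as ordered pairs of vertices. -/
def arcSet {V : Type*} (D : Digraph V) : Set (V × V) :=
  {a | D.Adj a.1 a.2}

/-- The digraph whose arcs are exactly the elements of `S`. -/
def ofArcSet {V : Type*} (S : Set (V × V)) : Digraph V where
  Adj u v := (u, v) ∈ S

/-- `C` is the arc set of a directed Hamilton cycle of `D`: for some cyclic enumeration
`v 0, v 1, …, v (n - 1)` of all the vertices, each listed exactly once (indices modulo the
number `n` of vertices), `C` consists of the arcs `(v i, v (i + 1))`, all of which are arcs
of `D`. -/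
def IsHamiltonCycle {V : Type*} [Finite V] (D : Digraph V) (C : Set (V × V)) : Prop :=
  ∃ v : ZMod (Nat.card V) ≃ V,
    C = Set.range (fun i => (v i, v (i + 1))) ∧ C ⊆ D.arcSet

/-- `F` is a family of pairwise arc-disjoint directed Hamilton cycles of `D`, each cycle being
given by its arc set. -/
def IsHamiltonPacking {V : Type*} [Finite V] (D : Digraph V) (F : Finset (Set (V × V))) : Prop :=
  (∀ C ∈ F, D.IsHamiltonCycle C) ∧
    ∀ C ∈ F, ∀ C' ∈ F, C ≠ C' → Disjoint C C'

/-- Digraphs on the finite vertex set `Fin n` carry the discrete σ-algebra. -/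
instance instMeasurableSpaceFin (n : ℕ) : MeasurableSpace (Digraph (Fin n)) := ⊤

/-- The random digraph `D(n, p)`: the law of the digraph on `Fin n` that contains each of the
`n (n - 1)` arcs `(u, v)` with `u ≠ v` independently with probability `p`, and no loops. -/
noncomputable def random (n : ℕ) (p : unitInterval) : MeasureTheory.Measure (Digraph (Fin n)) :=
  (ProbabilityTheory.setBernoulli {a : Fin n × Fin n | a.1 ≠ a.2} p).map ofArcSet

theorem measurable_ofArcSet (n : ℕ) :
    Measurable (ofArcSet : Set (Fin n × Fin n) → Digraph (Fin n)) :=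
  measurable_of_countable _

instance instIsProbabilityMeasureRandom (n : ℕ) (p : unitInterval) :
    MeasureTheory.IsProbabilityMeasure (random n p) :=
  MeasureTheory.Measure.isProbabilityMeasure_map (measurable_ofArcSet n).aemeasurable

end Digraph

/-! Split the vertices into `L` clusters of equal size `m`, indexed by the residues modulo a prime
`L` of order log² n, and fewer than `L` leftovers. For a nonzero residue `a` the step `c ↦ c + a`
runs through all clusters, and an arc between two distinct clusters belongs to exactly one step. For
a fixed step, take `(L - 1) * N` disjoint perfect matchings between each two consecutive clusters.
Concatenating one matching from every slot but one gives `m` disjoint paths, which a last matching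
in the omitted slot has to close to a single cycle. The slot that leaves cluster `a` also contains
the leftovers on both sides, without arcs between two leftovers, so the paths absorb them. With `N`
about `p * m / L`, the `(L - 1) ^ 2 * N` cycles obtained are almost `n * p`.

Matchings: a bipartite graph has an `r`-factor once e(S, T) ≥ r(|S| + |T| - |Z|) for all S, T
(`exists_regular_subgraph`), and a regular bipartite graph splits into perfect matchings. Chernoff
and a union bound give this condition for `r` close to the expected degree
(`measureReal_not_exists_perms`).

Closing: every arc gets a random label, namely absent, matching arc, or reserved for one of `N`
closing rounds, each round with probability `q = 64 log n / m`. The paths do not depend on the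
labels in their closing slot (`pathPerm_congr`), so conditionally the last matching is sought in a
fresh random bipartite graph of density `q`. Contracting the paths turns this into a Hamilton cycle
of a random digraph on `m` vertices (`measureReal_not_exists_cyclic`). McDiarmid's coupling
(`hasCycleThrough_mcdiarmid`) replaces that digraph by a random graph, where Pósa rotations apply.

Choice of `L`: the reserved arcs take a proportion of about 64 log n / L of all arcs, which is
negligible for `L` of order log² n. Rounding `N` to an integer loses up to `(L - 1) ^ 2` cycles, of
order log⁴ n, which is o(np) by hypothesis. -/

namespace HamiltonPacking

open MeasureTheory ProbabilityTheory

/-! ### Independent Bernoulli families: conditioning and the lower Chernoff tail -/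

section Probability

variable {Ω : Type*} [MeasurableSpace Ω] {μ : Measure Ω}

/-- `ξ` is a family of independent random propositions, each true with probability `q`. -/
structure IsBernoulliFamily {β : Type*} (ξ : β → Ω → Prop) (q : ℝ) (μ : Measure Ω) : Prop where
  measurable : ∀ b, Measurable (ξ b)
  indep : iIndepFun ξ μ
  prob : ∀ b, μ.real {ω | ξ b ω} = q

lemma IsBernoulliFamily.precomp {β γ : Type*} {ξ : β → Ω → Prop} {q : ℝ}
    (h : IsBernoulliFamily ξ q μ) {g : γ → β} (hg : Function.Injective g) :
    IsBernoulliFamily (fun c => ξ (g c)) q μ :=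
  ⟨fun _ => h.measurable _, h.indep.precomp hg, fun _ => h.prob _⟩

section Decoupling

universe u v

variable {β : Type u} {Λ : Type v} [Fintype β] [Fintype Λ] [MeasurableSpace Λ] [DiscreteMeasurableSpace Λ]
  {X : β → Ω → Λ}

/-- Freezing the coordinates outside `T` of an independent family. -/
lemma measureReal_decouple [IsProbabilityMeasure μ] [Nonempty Λ] (hm : ∀ b, Measurable (X b))
    (hX : iIndepFun X μ)
    (T : Set β) : ∃ (ι : Type (max u v)) (_ : Fintype ι) (w : ι → ℝ) (F : ι → β → Λ),
      (∀ i, 0 ≤ w i) ∧ ∑ i, w i = 1 ∧ ∀ P : (β → Λ) → (β → Λ) → Prop,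
      (∀ f f' g g', (∀ b ∉ T, f b = f' b) → (∀ b ∈ T, g b = g' b) → P f g → P f' g') →
      μ.real {ω | P (fun b => X b ω) (fun b => X b ω)} =
        ∑ i, w i * μ.real {ω | P (F i) (fun b => X b ω)} := by
  classical
  let S : Finset β := Finset.univ.filter (· ∉ T)
  let T' : Finset β := Finset.univ.filter (· ∈ T)
  have hST : Disjoint S T' := by
    rw [Finset.disjoint_left]; intro b hb hb'; simp [S, T'] at hb hb'; exact hb hb'
  have hind := hX.indepFun_finset S T' hST hm
  -- The value filled in on the other coordinates is arbitrary, as `P` does not look at them.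
  let F : (S → Λ) → β → Λ := fun f b => if h : b ∈ S then f ⟨b, h⟩ else Classical.arbitrary Λ
  let G : (T' → Λ) → β → Λ := fun f b => if h : b ∈ T' then f ⟨b, h⟩ else Classical.arbitrary Λ
  let XS : Ω → S → Λ := fun ω i => X i ω
  let XT : Ω → T' → Λ := fun ω i => X i ω
  have hXS : Measurable XS := measurable_pi_lambda _ fun i => hm i
  have hXT : Measurable XT := measurable_pi_lambda _ fun i => hm i
  have key : ∀ P : (β → Λ) → (β → Λ) → Prop,
      (∀ f f' g g', (∀ b ∉ T, f b = f' b) → (∀ b ∈ T, g b = g' b) → P f g → P f' g') →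
      μ.real {ω | P (fun b => X b ω) (fun b => X b ω)} =
        ∑ i, μ.real (XS ⁻¹' {i}) * μ.real {ω | P (F i) (fun b => X b ω)} := by
    intro P hP
    have e1 : {ω | P (fun b => X b ω) (fun b => X b ω)} =
        ⋃ i ∈ (Finset.univ : Finset (S → Λ)), (XS ⁻¹' {i} ∩ XT ⁻¹' {g | P (F i) (G g)}) := by
      ext ω
      simp only [Set.mem_ofPred_eq, Finset.mem_univ, Set.iUnion_true, Set.mem_iUnion, Set.mem_inter_iff,
        Set.mem_preimage, Set.mem_singleton_iff, exists_eq_left']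
      constructor
      · refine hP _ _ _ _ ?_ ?_
        · intro b hb; simp [F, XS, S, hb]
        · intro b hb; simp [G, XT, T', hb]
      · refine hP _ _ _ _ ?_ ?_
        · intro b hb; simp [F, XS, S, hb]
        · intro b hb; simp [G, XT, T', hb]
    rw [e1, measureReal_biUnion_finset]
    · refine Finset.sum_congr rfl fun i _ => ?_
      have e2 : {ω | P (F i) (fun b => X b ω)} = XT ⁻¹' {g | P (F i) (G g)} := by
        ext ω
        simp only [Set.mem_ofPred_eq, Set.mem_preimage]
        constructor
        · refine hP _ _ _ _ (fun _ _ => rfl) ?_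
          intro b hb; simp [G, XT, T', hb]
        · refine hP _ _ _ _ (fun _ _ => rfl) ?_
          intro b hb; simp [G, XT, T', hb]
      rw [e2]
      have := hind.measure_inter_preimage_eq_mul {i} {g | P (F i) (G g)} .of_discrete .of_discrete
      simp only [measureReal_def]
      rw [← ENNReal.toReal_mul]
      exact congrArg _ this
    · intro i _ j _ hij
      refine Set.disjoint_left.2 ?_
      rintro ω ⟨h1, _⟩ ⟨h2, _⟩
      exact hij (h1.symm.trans h2)
    · intro i _
      exact (hXS .of_discrete).inter (hXT .of_discrete)
  refine ⟨S → Λ, inferInstance, fun i => μ.real (XS ⁻¹' {i}), F, fun i => measureReal_nonneg, ?_, key⟩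
  have := key (fun _ _ => True) (by simp)
  simpa using this.symm

/-- Law of total probability: the probability is a convex combination of probabilities with the
coordinates outside `T` frozen. It serves to expose randomness in two stages. -/
lemma measureReal_decouple_le [IsProbabilityMeasure μ] [Nonempty Λ] (hm : ∀ b, Measurable (X b))
    (hX : iIndepFun X μ) (T : Set β) (P : (β → Λ) → (β → Λ) → Prop)
    (hP : ∀ f f' g g', (∀ b ∉ T, f b = f' b) → (∀ b ∈ T, g b = g' b) → P f g → P f' g')
    {c : ℝ} (hc : ∀ f, μ.real {ω | P f (fun b => X b ω)} ≤ c) :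
    μ.real {ω | P (fun b => X b ω) (fun b => X b ω)} ≤ c := by
  obtain ⟨ι, _, w, F, hw, hw1, h⟩ := measureReal_decouple hm hX T
  rw [h P hP]
  calc _ ≤ ∑ i, w i * c := Finset.sum_le_sum fun i _ => mul_le_mul_of_nonneg_left (hc _) (hw i)
    _ = c := by rw [← Finset.sum_mul, hw1, one_mul]

lemma measureReal_decouple_mono [IsProbabilityMeasure μ] [Nonempty Λ] (hm : ∀ b, Measurable (X b))
    (hX : iIndepFun X μ) (T : Set β) (P Q : (β → Λ) → (β → Λ) → Prop)
    (hP : ∀ f f' g g', (∀ b ∉ T, f b = f' b) → (∀ b ∈ T, g b = g' b) → P f g → P f' g')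
    (hQ : ∀ f f' g g', (∀ b ∉ T, f b = f' b) → (∀ b ∈ T, g b = g' b) → Q f g → Q f' g')
    (hPQ : ∀ f, μ.real {ω | P f (fun b => X b ω)} ≤ μ.real {ω | Q f (fun b => X b ω)}) :
    μ.real {ω | P (fun b => X b ω) (fun b => X b ω)} ≤
      μ.real {ω | Q (fun b => X b ω) (fun b => X b ω)} := by
  obtain ⟨ι, _, w, F, hw, hw1, h⟩ := measureReal_decouple hm hX T
  rw [h P hP, h Q hQ]
  exact Finset.sum_le_sum fun i _ => mul_le_mul_of_nonneg_left (hPQ _) (hw i)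

end Decoupling

variable {β : Type*} {ξ : β → Ω → Prop} {q : ℝ}

lemma IsBernoulliFamily.measurableSet (h : IsBernoulliFamily ξ q μ) (b : β) :
    MeasurableSet {ω | ξ b ω} := measurableSet_setOfPred.2 (h.measurable b)

lemma IsBernoulliFamily.measureReal_forall_not [IsProbabilityMeasure μ]
    (h : IsBernoulliFamily ξ q μ) (s : Finset β) :
    μ.real {ω | ∀ b ∈ s, ¬ ξ b ω} = (1 - q) ^ s.card := by
  have e : {ω | ∀ b ∈ s, ¬ ξ b ω} = ⋂ b ∈ s, ξ b ⁻¹' {False} := by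
    ext ω; simp
  have := h.indep.measure_inter_preimage_eq_mul s (sets := fun _ => {False})
    (fun i _ => .of_discrete)
  rw [e, measureReal_def, this, ENNReal.toReal_prod, Finset.prod_eq_pow_card]
  intro b _
  have e2 : ξ b ⁻¹' {False} = {ω | ξ b ω}ᶜ := by ext ω; simp
  rw [e2, ← measureReal_def, probReal_compl_eq_one_sub (h.measurableSet b), h.prob]

open Classical in
/-- Lower tail Chernoff bound. -/
lemma IsBernoulliFamily.measureReal_card_le [IsProbabilityMeasure μ]
    (h : IsBernoulliFamily ξ q μ) (s : Finset β) {δ : ℝ} (hδ : 0 ≤ δ) :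
    μ.real {ω | ((s.filter (fun b => ξ b ω)).card : ℝ) ≤ (1 - δ) * (q * s.card)} ≤
      Real.exp (-(δ ^ 2 / 2 * (q * s.card))) := by
  let Y : β → Ω → ℝ := fun b ω => if ξ b ω then 1 else 0
  have hYm : ∀ b, Measurable (Y b) := fun b =>
    Measurable.ite (h.measurableSet b) measurable_const measurable_const
  have hYi : iIndepFun Y μ :=
    h.indep.comp (fun _ (a : Prop) => if a then (1 : ℝ) else 0) (fun _ => .of_discrete)
  have hcard : ∀ ω, ((s.filter (fun b => ξ b ω)).card : ℝ) = (∑ b ∈ s, Y b) ω := by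
    intro ω; simp [Y, Finset.sum_apply]
  have hmgf : ∀ b, mgf (Y b) μ (-δ) = 1 + q * (Real.exp (-δ) - 1) := by
    intro b
    have e : (fun ω => Real.exp (-δ * Y b ω)) =
        fun ω => 1 + {ω | ξ b ω}.indicator (fun _ => Real.exp (-δ) - 1) ω := by
      ext ω
      by_cases hb : ξ b ω <;> simp [Y, hb]
    rw [mgf, e, integral_add (integrable_const _)
      ((integrable_const _).indicator (h.measurableSet b)),
      integral_indicator_const _ (h.measurableSet b), h.prob]
    simp
  have hbound : ∀ b, mgf (Y b) μ (-δ) ≤ Real.exp (q * (-δ + δ ^ 2 / 2)) := by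
    intro b
    have hq : 0 ≤ q := by rw [← h.prob b]; exact measureReal_nonneg
    -- Follows from e^δ ≥ 1 + δ + δ²/2, since (1 - δ + δ²/2)(1 + δ + δ²/2) = 1 + δ⁴/4 ≥ 1.
    have h1 : Real.exp (-δ) ≤ 1 - δ + δ ^ 2 / 2 := by
      have h2 := Real.quadratic_le_exp_of_nonneg hδ
      have h3 : 0 < Real.exp δ := Real.exp_pos _
      have h4 : 0 ≤ 1 - δ + δ ^ 2 / 2 := by nlinarith [sq_nonneg (δ - 1)]
      rw [Real.exp_neg, inv_le_iff_one_le_mul₀ h3]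
      nlinarith [mul_le_mul_of_nonneg_left h2 h4, sq_nonneg (δ ^ 2)]
    rw [hmgf]
    calc 1 + q * (Real.exp (-δ) - 1) ≤ q * (-δ + δ ^ 2 / 2) + 1 := by nlinarith
      _ ≤ _ := Real.add_one_le_exp _
  have hsum : mgf (∑ b ∈ s, Y b) μ (-δ) ≤ Real.exp (s.card * (q * (-δ + δ ^ 2 / 2))) := by
    rw [hYi.mgf_sum hYm, Real.exp_nat_mul]
    exact (Finset.prod_le_prod (fun _ _ => mgf_nonneg) (fun b _ => hbound b)).trans (by simp)
  have hexp_int : Integrable (fun ω => Real.exp (-δ * (∑ b ∈ s, Y b) ω)) μ := by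
    refine Integrable.of_bound (C := 1) ?_ ?_
    · have : Measurable (∑ b ∈ s, Y b) := by
        rw [Finset.sum_fn]
        exact Finset.measurable_sum _ fun b _ => hYm b
      exact (Real.measurable_exp.comp (this.const_mul _)).aestronglyMeasurable
    · refine Filter.Eventually.of_forall fun ω => ?_
      rw [Real.norm_eq_abs, Real.abs_exp, Real.exp_le_one_iff, ← hcard]
      have : (0 : ℝ) ≤ ((s.filter (fun b => ξ b ω)).card : ℝ) := by positivity
      nlinarith
  simp only [hcard]
  refine (measure_le_le_exp_mul_mgf _ (by linarith : -δ ≤ 0) hexp_int).trans ?_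
  refine (mul_le_mul_of_nonneg_left hsum (Real.exp_nonneg _)).trans ?_
  rw [← Real.exp_add]
  refine Real.exp_le_exp.2 (le_of_eq ?_)
  ring

end Probability

/-! ### Pósa rotations of longest paths -/

section Rotation

variable {U : Type*} {G : U → U → Prop} {A : Set U}

/-- A path of the graph `G` all of whose vertices lie in `A`, as a list of vertices. -/
def IsPathIn (G : U → U → Prop) (A : Set U) (l : List U) : Prop :=
  l.Nodup ∧ l.IsChain G ∧ ∀ x ∈ l, x ∈ A

/-- A path of maximum length among the paths of `G` inside `A`. -/
def IsLongestPathIn (G : U → U → Prop) (A : Set U) (l : List U) : Prop :=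
  IsPathIn G A l ∧ ∀ l', IsPathIn G A l' → l'.length ≤ l.length

/-- The paths obtained from `l₀` by Pósa rotations that keep the last vertex fixed. -/
inductive Rotates (G : U → U → Prop) (l₀ : List U) : List U → Prop
  | refl : Rotates G l₀ l₀
  | step (x : U) (t : List U) (w : U) (s : List U) (h : Rotates G l₀ ((x :: t) ++ w :: s))
      (hxw : G x w) : Rotates G l₀ ((x :: t).reverse ++ w :: s)

/-- The first vertices of the rotations of `l₀`. -/
def rotationEnds (G : U → U → Prop) (l₀ : List U) : Set U :=
  {x | ∃ l, Rotates G l₀ l ∧ l.head? = some x}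

lemma Rotates.perm {l₀ l : List U} (h : Rotates G l₀ l) : l.Perm l₀ := by
  induction h with
  | refl => rfl
  | step x t w s h hxw ih =>
    exact ((List.reverse_perm _).append_right _).trans ih

lemma Rotates.isChain (hG : ∀ x y, G x y → G y x) {l₀ l : List U} (h : Rotates G l₀ l)
    (h₀ : l₀.IsChain G) : l.IsChain G := by
  induction h with
  | refl => exact h₀
  | step x t w s h hxw ih =>
    rw [List.isChain_append] at ih ⊢
    refine ⟨?_, ih.2.1, ?_⟩
    · rw [List.isChain_reverse]
      exact ih.1.imp fun a b hab => hG _ _ hab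
    · intro a ha b hb
      simp at ha hb
      subst ha hb
      exact hxw

lemma Rotates.getLast? {l₀ l : List U} (h : Rotates G l₀ l) : l.getLast? = l₀.getLast? := by
  induction h with
  | refl => rfl
  | step x t w s h hxw ih => 
    rw [← ih, List.getLast?_append, List.getLast?_append]
    simp [List.getLast?_cons]

lemma infix_pair_append {a b : U} {l₁ l₂ : List U} (h : [a, b] <:+: l₁ ++ l₂) :
    [a, b] <:+: l₁ ∨ [a, b] <:+: l₂ ∨ (l₁.getLast? = some a ∧ l₂.head? = some b) := by
  obtain ⟨s, t, h⟩ := h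
  rw [List.append_assoc, List.append_eq_append_iff] at h
  rcases h with ⟨c, hc, hc'⟩ | ⟨c, hc, hc'⟩
  · match c with
    | [] => right; left; simp at hc'; exact ⟨[], t, by simp [hc']⟩
    | [d] =>
      right; right
      simp at hc'
      rw [hc, ← hc'.2, ← hc'.1]; simp
    | d :: e :: f =>
      left
      simp at hc'
      rw [hc, hc'.1, hc'.2.1]
      exact ⟨s, f, by simp⟩
  · right; left
    exact ⟨c, t, by simp [hc']⟩

/-- A rotation breaks a single consecutive pair, and the first vertex of that pair becomes the new
head, hence a rotation end. A pair without rotation ends is therefore never broken; only its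
direction can change. -/
lemma Rotates.infix_pair {l₀ l : List U} (h : Rotates G l₀ l) {a b : U} (hab : [a, b] <:+: l₀)
    (ha : a ∉ rotationEnds G l₀) (hb : b ∉ rotationEnds G l₀) :
    [a, b] <:+: l ∨ [b, a] <:+: l := by
  induction h with
  | refl => exact Or.inl hab
  | step x t w s h hxw ih =>
    have hstep := Rotates.step x t w s h hxw
    have key : ∀ c d : U, c ∉ rotationEnds G l₀ → [c, d] <:+: (x :: t) ++ w :: s →
        [c, d] <:+: (x :: t).reverse ++ w :: s ∨ [d, c] <:+: (x :: t).reverse ++ w :: s := by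
      intro c d hc hcd
      rcases infix_pair_append hcd with h1 | h1 | ⟨h1, h2⟩
      · right
        refine List.IsInfix.trans ?_ (List.prefix_append _ _).isInfix
        simpa using List.reverse_infix.2 h1
      · left
        exact h1.trans (List.suffix_append _ _).isInfix
      · exfalso
        refine hc ⟨_, hstep, ?_⟩
        rw [List.head?_append, List.head?_reverse, h1]; rfl
    rcases ih with h1 | h1
    · exact key _ _ ha h1
    · exact (key _ _ hb h1).symm

lemma eq_of_nodup_append_cons {l₁ l₂ t₁ t₂ : List U} {b : U} (h : (l₁ ++ b :: t₁).Nodup)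
    (he : l₁ ++ b :: t₁ = l₂ ++ b :: t₂) : l₁ = l₂ ∧ t₁ = t₂ := by
  have h2 := he ▸ h
  rw [List.append_eq_append_iff] at he
  rcases he with ⟨c, rfl, hc⟩ | ⟨c, rfl, hc⟩
  · cases c with
    | nil => simpa using hc
    | cons d c => simp at hc; simp [List.nodup_append, ← hc.1] at h2
  · cases c with
    | nil => simpa using hc.symm
    | cons d c => simp at hc; simp [List.nodup_append, ← hc.1] at h

lemma nodup_infix_left {l : List U} (hl : l.Nodup) {a a' b : U} (h : [a, b] <:+: l)
    (h' : [a', b] <:+: l) : a = a' := by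
  obtain ⟨s, t, rfl⟩ := h
  obtain ⟨s', t', h'⟩ := h'
  have e : (s ++ [a]) ++ b :: t = (s' ++ [a']) ++ b :: t' := by simpa using h'.symm
  have := (eq_of_nodup_append_cons (by simpa using hl) e).1
  simpa using (List.append_inj' this rfl).2

lemma nodup_infix_right {l : List U} (hl : l.Nodup) {a b b' : U} (h : [a, b] <:+: l)
    (h' : [a, b'] <:+: l) : b = b' := by
  obtain ⟨s, t, rfl⟩ := h
  obtain ⟨s', t', h'⟩ := h'
  have e : s ++ a :: (b :: t) = s' ++ a :: (b' :: t') := by simpa using h'.symm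
  have := (eq_of_nodup_append_cons (by simpa using hl) e).2
  simp at this
  exact this.1

/-- Pósa's rotation lemma: an outside neighbour of a rotation end is next to a rotation end on the
original path, or is the fixed last vertex. -/
lemma rotationEnds_neighbor (hG : ∀ x y, G x y → G y x) {l₀ : List U}
    (h₀ : IsLongestPathIn G A l₀) {x y : U} (hx : x ∈ rotationEnds G l₀) (hy : y ∈ A)
    (hyR : y ∉ rotationEnds G l₀) (hxy : G x y) :
    (∃ z ∈ rotationEnds G l₀, [z, y] <:+: l₀ ∨ [y, z] <:+: l₀) ∨ l₀.getLast? = some y := by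
  obtain ⟨l, hl, hlx⟩ := hx
  have hnd : l.Nodup := hl.perm.nodup_iff.2 h₀.1.1
  have hyl : y ∈ l := by
    by_contra hyl
    have : IsPathIn G A (y :: l) := by
      refine ⟨List.nodup_cons.2 ⟨hyl, hnd⟩, ?_, ?_⟩
      · rw [List.isChain_cons]
        refine ⟨fun z hz => ?_, hl.isChain hG h₀.1.2.1⟩
        rw [hlx] at hz
        simp at hz
        subst hz
        exact hG _ _ hxy
      · intro z hz
        rcases List.mem_cons.1 hz with rfl | hz
        · exact hy
        · exact h₀.1.2.2 z (hl.perm.mem_iff.1 hz)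
    have := h₀.2 _ this
    simp [hl.perm.length_eq] at this
  by_contra hcon
  push Not at hcon
  obtain ⟨hz, hlast⟩ := hcon
  -- the predecessor of `y` on the rotated path becomes a rotation end
  obtain ⟨l1, l2, rfl⟩ := List.append_of_mem hyl
  match l1 with
  | [] =>
    simp at hlx
    subst hlx
    exact hyR ⟨_, hl, rfl⟩
  | x' :: t =>
    have : x' = x := by simpa using hlx
    subst this
    obtain ⟨z, t', ht⟩ : ∃ z t', (x' :: t) = t' ++ [z] :=
      ⟨_, _, (List.dropLast_append_getLast (List.cons_ne_nil x' t)).symm⟩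
    have hzR : z ∈ rotationEnds G l₀ := by
      refine ⟨_, Rotates.step x' t y l2 hl hxy, ?_⟩
      rw [ht]; simp
    have hzy : [z, y] <:+: (x' :: t) ++ y :: l2 := ⟨t', l2, by rw [ht]; simp⟩
    have hy0 : y ∈ l₀ := hl.perm.mem_iff.1 hyl
    obtain ⟨m1, m2, hm⟩ := List.append_of_mem hy0
    rcases List.eq_nil_or_concat m1 with rfl | ⟨m, a, rfl⟩
    · exact hyR ⟨l₀, .refl, by simp [hm]⟩
    match m2 with
    | [] => exact hlast (by simp [hm])
    | b :: m2 =>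
      have hay : [a, y] <:+: l₀ := ⟨m, b :: m2, by simp [hm]⟩
      have hyb : [y, b] <:+: l₀ := ⟨m ++ [a], m2, by simp [hm]⟩
      have haR : a ∉ rotationEnds G l₀ := fun h => (hz a h).1 hay
      have hbR : b ∉ rotationEnds G l₀ := fun h => (hz b h).2 hyb
      have hab : a ≠ b := by
        rintro rfl
        have := h₀.1.1
        rw [hm] at this
        simp [List.nodup_append] at this
      -- Both original neighbours `a`, `b` of `y` are still next to `y` on the rotated path. One of
      -- them thus precedes `y` there and equals the rotation end `z`, a contradiction.
      rcases hl.infix_pair hay haR hyR with h1 | h1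
      · exact haR (nodup_infix_left hnd h1 hzy ▸ hzR)
      · rcases hl.infix_pair hyb hyR hbR with h2 | h2
        · exact hab (nodup_infix_right hnd h1 h2)
        · exact hbR (nodup_infix_left hnd h2 hzy ▸ hzR)

-- `R` consists of all rotation ends. An outside neighbour of `R` is the successor or the
-- predecessor on `l₀` of a vertex of `R`, or the last vertex of `l₀`. Each vertex has at most one
-- successor and one predecessor, whence 2|R| + 1.
open Classical in
theorem exists_rotation_ends [Fintype U] (hG : ∀ x y, G x y → G y x) {l₀ : List U}
    (h₀ : IsLongestPathIn G A l₀) (hne : l₀ ≠ []) :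
    ∃ R : Finset U, R.Nonempty ∧
      (∀ x ∈ R, ∃ l, IsLongestPathIn G A l ∧ l.length = l₀.length ∧ l.head? = some x ∧
        l.getLast? = l₀.getLast?) ∧
      (Finset.univ.filter (fun y => y ∈ A ∧ y ∉ R ∧ ∃ x ∈ R, G x y)).card ≤ 2 * R.card + 1 := by
  let R : Finset U := Finset.univ.filter (· ∈ rotationEnds G l₀)
  have hR : ∀ x, x ∈ R ↔ x ∈ rotationEnds G l₀ := by simp [R]
  refine ⟨R, ⟨l₀.head hne, (hR _).2 ⟨l₀, .refl, List.head?_eq_some_head hne⟩⟩, ?_, ?_⟩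
  · intro x hx
    obtain ⟨l, hl, hlx⟩ := (hR x).1 hx
    refine ⟨l, ⟨⟨hl.perm.nodup_iff.2 h₀.1.1, hl.isChain hG h₀.1.2.1, fun z hz =>
      h₀.1.2.2 z (hl.perm.mem_iff.1 hz)⟩, fun l' hl' => ?_⟩, hl.perm.length_eq, hlx, hl.getLast?⟩
    rw [hl.perm.length_eq]
    exact h₀.2 l' hl'
  · let f : U → U := fun z => if h : ∃ y, [z, y] <:+: l₀ then h.choose else z
    let g : U → U := fun z => if h : ∃ y, [y, z] <:+: l₀ then h.choose else z
    have hsub : Finset.univ.filter (fun y => y ∈ A ∧ y ∉ R ∧ ∃ x ∈ R, G x y) ⊆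
        (R.image f ∪ R.image g) ∪ {l₀.getLast hne} := by
      intro y hy
      simp only [Finset.mem_filter, Finset.mem_univ, true_and] at hy
      obtain ⟨hyA, hyR, x, hx, hxy⟩ := hy
      rw [hR] at hyR hx
      simp only [Finset.mem_union, Finset.mem_image, Finset.mem_singleton]
      rcases rotationEnds_neighbor hG h₀ hx hyA hyR hxy with ⟨z, hz, h1 | h1⟩ | h1
      · refine Or.inl (Or.inl ⟨z, (hR z).2 hz, ?_⟩)
        have h : ∃ y, [z, y] <:+: l₀ := ⟨y, h1⟩
        simp only [f, dif_pos h]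
        exact nodup_infix_right h₀.1.1 h.choose_spec h1
      · refine Or.inl (Or.inr ⟨z, (hR z).2 hz, ?_⟩)
        have h : ∃ y, [y, z] <:+: l₀ := ⟨y, h1⟩
        simp only [g, dif_pos h]
        exact nodup_infix_left h₀.1.1 h.choose_spec h1
      · right
        rw [List.getLast?_eq_some_getLast hne] at h1
        simpa using h1.symm
    refine (Finset.card_le_card hsub).trans ((Finset.card_union_le _ _).trans ?_)
    have := Finset.card_union_le (R.image f) (R.image g)
    have h1 := Finset.card_image_le (s := R) (f := f)
    have h2 := Finset.card_image_le (s := R) (f := g)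
    simp only [Finset.card_singleton]
    omega

lemma exists_isLongestPathIn [Fintype U] (G : U → U → Prop) (A : Set U) :
    ∃ l, IsLongestPathIn G A l := by
  classical
  have hb : ∀ l : List U, IsPathIn G A l → l.length ≤ Fintype.card U := fun l hl =>
    hl.1.length_le_card
  let S : Set ℕ := {k | ∃ l, IsPathIn G A l ∧ l.length = k}
  have hS : S.Nonempty := ⟨0, [], ⟨by simp, by simp, by simp⟩, rfl⟩
  have hbd : BddAbove S := ⟨Fintype.card U, by rintro _ ⟨l, hl, rfl⟩; exact hb l hl⟩
  obtain ⟨l, hl, h⟩ := Nat.sSup_mem hS hbd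
  exact ⟨l, hl, fun l' hl' => h ▸ le_csSup hbd ⟨l', hl', rfl⟩⟩

end Rotation

/-! ### McDiarmid's coupling between random graphs and random digraphs -/

section Coupling

variable {U : Type*}

/-- `l` lists all elements of `U` along a path of `S` that starts in `A` and ends in `B`. -/
def IsHamiltonPath (S : U → U → Prop) (A B : U → Prop) (l : List U) : Prop :=
  l.Nodup ∧ (∀ u, u ∈ l) ∧ l.IsChain S ∧ (∃ x, l.head? = some x ∧ A x) ∧
    ∃ y, l.getLast? = some y ∧ B y

lemma isChain_of_infix {S S' : U → U → Prop} {l : List U} (h : l.IsChain S)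
    (hS : ∀ x y, [x, y] <:+: l → S x y → S' x y) : l.IsChain S' := by
  rw [List.isChain_iff_forall_rel_of_append_cons_cons] at h ⊢
  intro a b l1 l2 hl
  exact hS a b ⟨l1, l2, by simp [hl]⟩ (h hl)

lemma not_infix_swap {l : List U} (hl : l.Nodup) {a b : U} (h : [a, b] <:+: l) :
    ¬ [b, a] <:+: l := by
  intro h'
  obtain ⟨s, t, rfl⟩ := h
  obtain ⟨s', t', h'⟩ := h'
  have e : s ++ a :: (b :: t) = (s' ++ [b]) ++ a :: t' := by simpa using h'.symm
  have := (eq_of_nodup_append_cons (by simpa using hl) e).1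
  subst this
  simp [List.nodup_append] at hl

variable [LinearOrder U]

/-- The relation that reads both directions of the pairs `(a, b)` with `a < b` from `f` if the
pair lies in `T`, and otherwise uses `f (a, b)` for both directions. -/
def partialSymm (T : Finset (U × U)) (f : Option U × Option U → Prop) (u v : U) : Prop :=
  if (min u v, max u v) ∈ T then f (some u, some v) else f (some (min u v), some (max u v))

/-- Some Hamilton path of `partialSymm T f` starts at an out-neighbour of `none` and ends at an
in-neighbour of `none`. -/
def HasCycleThrough (T : Finset (U × U)) (f : Option U × Option U → Prop) : Prop :=
  ∃ l, IsHamiltonPath (partialSymm T f) (fun u => f (none, some u)) (fun u => f (some u, none)) l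

lemma IsHamiltonPath.hasCycleThrough {S : U → U → Prop} {A B : U → Prop} {l : List U}
    (h : IsHamiltonPath S A B l) {T : Finset (U × U)} {f : Option U × Option U → Prop}
    (hS : ∀ x y, [x, y] <:+: l → S x y → partialSymm T f x y) (hA : ∀ x, A x → f (none, some x))
    (hB : ∀ x, B x → f (some x, none)) : HasCycleThrough T f := by
  obtain ⟨h1, h2, h3, ⟨x, hx, hAx⟩, y, hy, hBy⟩ := h
  exact ⟨l, h1, h2, isChain_of_infix h3 hS, ⟨x, hx, hA x hAx⟩, y, hy, hB y hBy⟩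

variable {Ω : Type*} [MeasurableSpace Ω] {μ : Measure Ω} [IsProbabilityMeasure μ]

/-- Condition on all arcs except those between `a` and `b`. If a suitable path exists even with the
pair absent, both events are certain. Otherwise the event on the left needs the single coordinate
`(a, b)`, so it has probability at most `q`. If it is possible at all, fix a path that realises it:
the path uses at most one direction of the pair, and the event on the right only needs that one arc,
which has probability `q`. -/
lemma hasCycleThrough_insert [Fintype U] {ξ : Option U × Option U → Ω → Prop} {q : ℝ}
    (h : IsBernoulliFamily ξ q μ) (T : Finset (U × U)) {a b : U} (hab : a < b) (hT : (a, b) ∉ T) :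
    μ.real {ω | HasCycleThrough T (fun e => ξ e ω)} ≤
      μ.real {ω | HasCycleThrough (insert (a, b) T) (fun e => ξ e ω)} := by
  classical
  let E : Set (Option U × Option U) := {(some a, some b), (some b, some a)}
  let mrg : (Option U × Option U → Prop) → (Option U × Option U → Prop) →
    (Option U × Option U → Prop) := fun f g e => if e ∈ E then g e else f e
  have hmrg : ∀ f f' g g', (∀ b ∉ E, f b = f' b) → (∀ b ∈ E, g b = g' b) →
      mrg f g = mrg f' g' := by
    intro f f' g g' h1 h2
    ext e
    by_cases he : e ∈ E
    · simp [mrg, he, h2 e he]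
    · simp [mrg, he, h1 e he]
  have hself : ∀ f, mrg f f = f := fun f => by ext e; simp [mrg]
  have main := measureReal_decouple_mono h.measurable h.indep E
    (fun f g => HasCycleThrough T (mrg f g))
    (fun f g => HasCycleThrough (insert (a, b) T) (mrg f g))
    (fun f f' g g' h1 h2 h3 => by rwa [← hmrg f f' g g' h1 h2])
    (fun f f' g g' h1 h2 h3 => by rwa [← hmrg f f' g g' h1 h2]) ?_
  · simpa only [hself] using main
  intro f
  have hAB : ∀ g g', (∀ x, mrg f g (none, some x) → mrg f g' (none, some x)) ∧
      (∀ x, mrg f g (some x, none) → mrg f g' (some x, none)) := by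
    intro g g'; simp [mrg, E]
  -- transfer of a path between two configurations
  have hother : ∀ g g' x y, ¬ (x = a ∧ y = b) → ¬ (x = b ∧ y = a) →
      partialSymm T (mrg f g) x y → partialSymm (insert (a, b) T) (mrg f g') x y := by
    intro g g' x y h1 h2 h3
    have hne : (min x y, max x y) ≠ (a, b) := by
      rcases le_total x y with hxy | hxy
      · simp [hxy]; tauto
      · simp [hxy]; tauto
    have hE1 : (some x, some y) ∉ E := by simp [E]; tauto
    have hE2 : (some (min x y), some (max x y)) ∉ E := by
      rcases le_total x y with hxy | hxy
      · simp [hxy, E]; tauto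
      · simp [hxy, E]; tauto
    simp only [partialSymm, Finset.mem_insert, hne, false_or] at h3 ⊢
    split_ifs at h3 ⊢ <;> simpa [mrg, hE1, hE2] using h3
  have hsymab : ∀ g, (partialSymm (insert (a, b) T) (mrg f g) a b ↔ g (some a, some b)) ∧
      (partialSymm (insert (a, b) T) (mrg f g) b a ↔ g (some b, some a)) := by
    intro g
    simp [partialSymm, min_eq_left hab.le, max_eq_right hab.le, min_eq_right hab.le,
      max_eq_left hab.le, mrg, E]
  have hsymab' : ∀ g, (partialSymm T (mrg f g) a b ↔ g (some a, some b)) ∧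
      (partialSymm T (mrg f g) b a ↔ g (some a, some b)) := by
    intro g
    simp [partialSymm, min_eq_left hab.le, max_eq_right hab.le, min_eq_right hab.le,
      max_eq_left hab.le, mrg, E, hT]
  -- a path that avoids one of the directions only needs the other one
  have hab1 : ∀ g l, IsHamiltonPath (partialSymm T (mrg f g)) (fun u => mrg f g (none, some u))
      (fun u => mrg f g (some u, none)) l → ¬ [b, a] <:+: l →
      ∀ g', g' (some a, some b) → HasCycleThrough (insert (a, b) T) (mrg f g') := by
    intro g l hl hba g' hg'
    refine hl.hasCycleThrough ?_ (hAB g g').1 (hAB g g').2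
    intro x y hxy hS
    by_cases h1 : x = a ∧ y = b
    · rw [h1.1, h1.2]; exact (hsymab g').1.2 hg'
    by_cases h2 : x = b ∧ y = a
    · rw [h2.1, h2.2] at hxy; exact absurd hxy hba
    exact hother g g' x y h1 h2 hS
  have hab2 : ∀ g l, IsHamiltonPath (partialSymm T (mrg f g)) (fun u => mrg f g (none, some u))
      (fun u => mrg f g (some u, none)) l → ¬ [a, b] <:+: l →
      ∀ g', g' (some b, some a) → HasCycleThrough (insert (a, b) T) (mrg f g') := by
    intro g l hl hba g' hg'
    refine hl.hasCycleThrough ?_ (hAB g g').1 (hAB g g').2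
    intro x y hxy hS
    by_cases h2 : x = b ∧ y = a
    · rw [h2.1, h2.2]; exact (hsymab g').2.2 hg'
    by_cases h1 : x = a ∧ y = b
    · rw [h1.1, h1.2] at hxy; exact absurd hxy hba
    exact hother g g' x y h1 h2 hS
  by_cases hex : ∃ g, HasCycleThrough T (mrg f g)
  · by_cases hneg : ∃ g, ¬ g (some a, some b) ∧ HasCycleThrough T (mrg f g)
    · obtain ⟨g, hg, l, hl⟩ := hneg
      have : ∀ g', HasCycleThrough (insert (a, b) T) (mrg f g') := by
        intro g'
        refine hl.hasCycleThrough ?_ (hAB g g').1 (hAB g g').2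
        intro x y hxy hS
        by_cases h1 : x = a ∧ y = b
        · rw [h1.1, h1.2] at hS; exact absurd ((hsymab' g).1.1 hS) hg
        by_cases h2 : x = b ∧ y = a
        · rw [h2.1, h2.2] at hS; exact absurd ((hsymab' g).2.1 hS) hg
        exact hother g g' x y h1 h2 hS
      exact measureReal_mono (fun ω _ => this _)
    · push Not at hneg
      have hle : μ.real {ω | HasCycleThrough T (mrg f (fun e => ξ e ω))} ≤ q := by
        rw [← h.prob (some a, some b)]
        refine measureReal_mono fun ω hω => ?_
        by_contra hc
        exact hneg _ hc hω
      refine hle.trans ?_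
      obtain ⟨g, l, hl⟩ := hex
      by_cases hin : [b, a] <:+: l
      · rw [← h.prob (some b, some a)]
        exact measureReal_mono fun ω hω => hab2 g l hl (not_infix_swap hl.1 hin) _ hω
      · rw [← h.prob (some a, some b)]
        exact measureReal_mono fun ω hω => hab1 g l hl hin _ hω
  · have : {ω | HasCycleThrough T (mrg f (fun e => ξ e ω))} = ∅ := by
      ext ω; simp only [Set.mem_ofPred_eq, Set.mem_empty_iff_false, iff_false]
      exact fun hc => hex ⟨_, hc⟩
    rw [this]
    simp

/-- McDiarmid's coupling: the random digraph is at least as likely to have a Hamilton cycle as the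
random graph. -/
theorem hasCycleThrough_mcdiarmid [Fintype U] {ξ : Option U × Option U → Ω → Prop} {q : ℝ}
    (h : IsBernoulliFamily ξ q μ) :
    μ.real {ω | HasCycleThrough (∅ : Finset (U × U)) (fun e => ξ e ω)} ≤
      μ.real {ω | ∃ l : List U, IsHamiltonPath (fun u v => ξ (some u, some v) ω)
        (fun u => ξ (none, some u) ω) (fun u => ξ (some u, none) ω) l} := by
  classical
  have key : ∀ T : Finset (U × U), (∀ e ∈ T, e.1 < e.2) →
      μ.real {ω | HasCycleThrough (∅ : Finset (U × U)) (fun e => ξ e ω)} ≤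
      μ.real {ω | HasCycleThrough T (fun e => ξ e ω)} := by
    intro T
    induction T using Finset.induction_on with
    | empty => intro _; exact le_rfl
    | insert e T heT ih =>
      intro hT
      exact (ih fun e he => hT e (Finset.mem_insert_of_mem he)).trans
        (hasCycleThrough_insert h T (hT e (Finset.mem_insert_self _ _)) heT)
  refine (key (Finset.univ.filter fun e => e.1 < e.2) (by simp)).trans (measureReal_mono ?_)
  rintro ω ⟨l, h1, h2, h3, h4, h5⟩
  refine ⟨l, h1, h2, h3.imp fun u v huv => ?_, h4, h5⟩
  unfold partialSymm at huv
  split_ifs at huv with hc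
  · exact huv
  · simp at hc
    subst hc
    simpa using huv

end Coupling

/-! ### Hamilton paths in expanders -/

section Expander

variable {U : Type*}

lemma IsLongestPathIn.ne_nil {G : U → U → Prop} {A : Set U} {l : List U}
    (h : IsLongestPathIn G A l) {x : U} (hx : x ∈ A) : l ≠ [] := by
  rintro rfl
  have := h.2 [x] ⟨by simp, by simp, by simpa using hx⟩
  simp at this

variable [Fintype U]

open Classical in
/-- Sets of at most `k` vertices have more than twice as many outside neighbours. -/
def IsExpander (k : ℕ) (G : U → U → Prop) : Prop :=
  ∀ S : Finset U, S.Nonempty → S.card ≤ k →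
    2 * S.card + 3 ≤ (Finset.univ.filter fun y => y ∉ S ∧ ∃ x ∈ S, G x y).card

open Classical in
/-- First vertices of the longest paths that avoid `w`. -/
noncomputable def avoidingEnds (G : U → U → Prop) (w : U) : Finset U :=
  Finset.univ.filter fun x => ∃ l, IsLongestPathIn G {w}ᶜ l ∧ l.head? = some x

lemma mem_avoidingEnds {G : U → U → Prop} {w x : U} :
    x ∈ avoidingEnds G w ↔ ∃ l, IsLongestPathIn G {w}ᶜ l ∧ l.head? = some x := by
  simp [avoidingEnds]

/-- The set `A` may miss the vertex `w`, which adds at most one outside neighbour to the 2|R| + 1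
allowed by rotations. The total 2|R| + 2 is just below what `IsExpander` demands, so `R` is too
large for the expansion hypothesis. -/
lemma IsExpander.exists_rotation_ends {k : ℕ} {G : U → U → Prop} (hk : IsExpander k G)
    (hG : ∀ x y, G x y → G y x) {A : Set U} {w : U} (hA : ∀ x, x ≠ w → x ∈ A) {l₀ : List U}
    (h₀ : IsLongestPathIn G A l₀) (hne : l₀ ≠ []) :
    ∃ R : Finset U, k < R.card ∧ ∀ x ∈ R, ∃ l, IsLongestPathIn G A l ∧
      l.length = l₀.length ∧ l.head? = some x ∧ l.getLast? = l₀.getLast? := by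
  classical
  obtain ⟨R, hR, h1, h2⟩ := HamiltonPacking.exists_rotation_ends hG h₀ hne
  refine ⟨R, ?_, h1⟩
  by_contra hc
  have h3 := hk R hR (by omega)
  have hsub : (Finset.univ.filter fun y => y ∉ R ∧ ∃ x ∈ R, G x y) ⊆
      insert w (Finset.univ.filter fun y => y ∈ A ∧ y ∉ R ∧ ∃ x ∈ R, G x y) := by
    intro y hy
    simp only [Finset.mem_filter, Finset.mem_univ, true_and, Finset.mem_insert] at hy ⊢
    by_cases hyw : y = w
    · exact Or.inl hyw
    · exact Or.inr ⟨hA y hyw, hy⟩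
  have h4 := (Finset.card_le_card hsub).trans (Finset.card_insert_le _ _)
  have h5 : (Finset.univ.filter fun y => y ∈ A ∧ y ∉ R ∧ ∃ x ∈ R, G x y).card ≤
    2 * R.card + 1 := by convert h2
  have h6 : 2 * R.card + 3 ≤ (Finset.univ.filter fun y => y ∉ R ∧ ∃ x ∈ R, G x y).card := by
    convert h3
  omega

lemma IsExpander.lt_card_avoidingEnds {k : ℕ} {G : U → U → Prop} (hk : IsExpander k G)
    (hG : ∀ x y, G x y → G y x) {v w : U} (hvw : v ≠ w) : k < (avoidingEnds G w).card := by
  classical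
  obtain ⟨l₀, h₀⟩ := exists_isLongestPathIn G ({w}ᶜ : Set U)
  obtain ⟨R, hR, h⟩ := hk.exists_rotation_ends hG (w := w) (by simp) h₀ (h₀.ne_nil (x := v) hvw)
  refine hR.trans_le (Finset.card_le_card fun x hx => ?_)
  obtain ⟨l, h1, _, h2, _⟩ := h x hx
  exact mem_avoidingEnds.2 ⟨l, h1, h2⟩

/-- If no vertex `w` is disconnected from the ends of the longest paths avoiding it, then longest
paths are Hamilton paths. -/
lemma mem_of_isLongestPathIn {G : U → U → Prop} (h : ∀ w, ∃ x ∈ avoidingEnds G w, G w x)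
    {l : List U} (hl : IsLongestPathIn G Set.univ l) (w : U) : w ∈ l := by
  classical
  -- If `l` misses `w`, it is no longer than a longest path avoiding `w`. Prepending `w` to such a
  -- path whose head is adjacent to `w` then beats `l`.
  by_contra hw
  obtain ⟨x, hx, hwx⟩ := h w
  obtain ⟨l', hl', hx⟩ := mem_avoidingEnds.1 hx
  have h1 : l.length ≤ l'.length := hl'.2 l ⟨hl.1.1, hl.1.2.1, by rintro y hy rfl; exact hw hy⟩
  have h2 := hl.2 (w :: l') ⟨List.nodup_cons.2 ⟨fun hw' => hl'.1.2.2 w hw' rfl, hl'.1.1⟩,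
    hl'.1.2.1.cons (by rw [hx]; simpa using hwx), by simp⟩
  simp at h2
  omega

/-- Many pairs of ends of Hamilton paths. -/
lemma IsExpander.exists_hamilton_ends [Nontrivial U] {k : ℕ} {G : U → U → Prop}
    (hk : IsExpander k G)
    (hG : ∀ x y, G x y → G y x) (h : ∀ w, ∃ x ∈ avoidingEnds G w, G w x) :
    ∃ (R : Finset U) (R' : U → Finset U), k < R.card ∧ ∀ y ∈ R, k < (R' y).card ∧
      ∀ x ∈ R' y, ∃ l : List U, l.Nodup ∧ (∀ u, u ∈ l) ∧ l.IsChain G ∧ l.head? = some x ∧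
        l.getLast? = some y := by
  classical
  obtain ⟨l₀, h₀⟩ := exists_isLongestPathIn G (Set.univ : Set U)
  obtain ⟨v⟩ : Nonempty U := inferInstance
  obtain ⟨R, hR, hR'⟩ := hk.exists_rotation_ends hG (w := v) (by simp) h₀
    (h₀.ne_nil (Set.mem_univ v))
  have : ∀ y ∈ R, ∃ R' : Finset U, k < R'.card ∧ ∀ x ∈ R', ∃ l : List U, l.Nodup ∧ (∀ u, u ∈ l) ∧
      l.IsChain G ∧ l.head? = some x ∧ l.getLast? = some y := by
    intro y hy
    obtain ⟨l, hl, hlen, hhead, hlast⟩ := hR' y hy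
    -- After reversal `y` is the last vertex, which rotations keep fixed while they vary the other
    -- end.
    have hrev : IsLongestPathIn G Set.univ l.reverse := by
      refine ⟨⟨List.nodup_reverse.2 hl.1.1, ?_, by simp⟩, by simpa using hl.2⟩
      rw [List.isChain_reverse]
      exact hl.1.2.1.imp fun a b hab => hG _ _ hab
    obtain ⟨R', h1, h2⟩ := hk.exists_rotation_ends hG (w := v) (by simp) hrev
      (hrev.ne_nil (Set.mem_univ v))
    refine ⟨R', h1, fun x hx => ?_⟩
    obtain ⟨l', hl', _, h3, h4⟩ := h2 x hx
    exact ⟨l', hl'.1.1, mem_of_isLongestPathIn h hl', hl'.1.2.1, h3, by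
      rw [h4, List.getLast?_reverse, hhead]⟩
  choose! R' hR'' using this
  exact ⟨R, R', hR, hR''⟩

/-- Since these ends do not depend on the edges at `w`, the edges at `w` are still fresh once the
ends are known. This takes the place of a separate sprinkling round. -/
lemma avoidingEnds_congr {G G' : U → U → Prop} {w : U}
    (h : ∀ u v, u ≠ w → v ≠ w → (G u v ↔ G' u v)) : avoidingEnds G w = avoidingEnds G' w := by
  classical
  have hp : ∀ l, IsPathIn G {w}ᶜ l ↔ IsPathIn G' {w}ᶜ l := by
    intro l
    unfold IsPathIn
    refine and_congr_right fun _ => ?_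
    constructor
    · rintro ⟨h1, h2⟩
      exact ⟨h1.imp_of_mem_imp fun u v hu hv huv => (h u v (h2 u hu) (h2 v hv)).1 huv, h2⟩
    · rintro ⟨h1, h2⟩
      exact ⟨h1.imp_of_mem_imp fun u v hu hv huv => (h u v (h2 u hu) (h2 v hv)).2 huv, h2⟩
  ext x
  simp only [mem_avoidingEnds, IsLongestPathIn, hp]

end Expander

/-! ### Two-stage exposure in the random graph -/

section RandomGraph

variable {U : Type*} [LinearOrder U]

/-- The random graph read off from the increasing pairs. -/
abbrev symmGraph (f : Option U × Option U → Prop) (u v : U) : Prop :=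
  f (some (min u v), some (max u v))

lemma symmGraph_symm (f : Option U × Option U → Prop) (u v : U) (h : symmGraph f u v) :
    symmGraph f v u := by
  simpa [symmGraph, min_comm, max_comm] using h

lemma hasCycleThrough_empty_of_path {f : Option U × Option U → Prop} {l : List U}
    (h1 : l.Nodup) (h2 : ∀ u, u ∈ l) (h3 : l.IsChain (symmGraph f)) {x y : U}
    (hx : l.head? = some x) (hy : l.getLast? = some y) (hA : f (none, some x))
    (hB : f (some y, none)) : HasCycleThrough (∅ : Finset (U × U)) f :=
  ⟨l, h1, h2, h3.imp fun u v huv => by simpa [partialSymm] using huv, ⟨x, hx, hA⟩, y, hy, hB⟩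

variable {Ω : Type*} [MeasurableSpace Ω] {μ : Measure Ω} [IsProbabilityMeasure μ]
  {ξ : Option U × Option U → Ω → Prop} {q : ℝ}

lemma pow_card_le {q : ℝ} (hq0 : 0 ≤ q) (hq1 : q ≤ 1) {k c : ℕ} (h : k ≤ c) :
    (1 - q) ^ c ≤ Real.exp (-(q * k)) := by
  calc (1 - q) ^ c ≤ (1 - q) ^ k := pow_le_pow_of_le_one (by linarith) (by linarith) h
    _ ≤ (Real.exp (-q)) ^ k := pow_le_pow_left₀ (by linarith) (Real.one_sub_le_exp_neg q) _
    _ = _ := by rw [← Real.exp_nat_mul]; congr 1; ring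

/-- Freeze all edges that avoid `w`; this determines the ends. The more than `k` independent pairs
between `w` and the ends are then all absent with probability at most (1 - q)^(k+1). -/
lemma measureReal_avoidingEnds [Fintype U] (h : IsBernoulliFamily ξ q μ) (hq0 : 0 ≤ q) (hq1 : q ≤ 1)
    (k : ℕ) (w : U) :
    μ.real {ω | k < (avoidingEnds (symmGraph fun e => ξ e ω) w).card ∧
      ∀ x ∈ avoidingEnds (symmGraph fun e => ξ e ω) w, ¬ symmGraph (fun e => ξ e ω) w x} ≤
      Real.exp (-(q * (k + 1 : ℕ))) := by
  classical
  refine measureReal_decouple_le h.measurable h.indep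
    {e | e.1 = some w ∨ e.2 = some w} (fun f g => k < (avoidingEnds (symmGraph f) w).card ∧
      ∀ x ∈ avoidingEnds (symmGraph f) w, ¬ symmGraph g w x) ?_ ?_
  · intro f f' g g' hf hg ⟨h1, h2⟩
    have e : avoidingEnds (symmGraph f) w = avoidingEnds (symmGraph f') w := by
      refine avoidingEnds_congr fun u v hu hv => ?_
      have := hf (some (min u v), some (max u v)) (by
        simp only [Set.mem_ofPred_eq, Option.some.injEq, not_or]
        rcases le_total u v with huv | huv <;> simp [huv, hu, hv])
      simp [symmGraph, this]
    rw [← e]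
    refine ⟨h1, fun x hx => ?_⟩
    have := hg (some (min w x), some (max w x)) (by
        simp only [Set.mem_ofPred_eq, Option.some.injEq]
        rcases le_total w x with huv | huv <;> simp [huv])
    simpa [symmGraph, ← this] using h2 x hx
  · intro f
    by_cases hk : k < (avoidingEnds (symmGraph f) w).card
    · simp only [hk, true_and]
      have hinj : Function.Injective (fun x : U => ((some (min w x), some (max w x)) :
          Option U × Option U)) := by
        intro x y hxy
        simp only [Prod.mk.injEq, Option.some.injEq] at hxy
        rcases le_total w x with h1 | h1 <;> rcases le_total w y with h2 | h2 <;>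
          simp [h1, h2] at hxy <;> grind
      have := (h.precomp hinj).measureReal_forall_not (avoidingEnds (symmGraph f) w)
      exact this.le.trans (pow_card_le hq0 hq1 hk)
    · simp only [hk, false_and]
      simp [Real.exp_nonneg]

lemma measureReal_no_edges (h : IsBernoulliFamily ξ q μ) (hq0 : 0 ≤ q) (hq1 : q ≤ 1)
    {S Y : Finset U} (hSY : Disjoint S Y) {c : ℕ} (hc : c ≤ S.card * Y.card) :
    μ.real {ω | ∀ x ∈ S, ∀ y ∈ Y, ¬ symmGraph (fun e => ξ e ω) x y} ≤ Real.exp (-(q * c)) := by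
  classical
  let e : U × U → Option U × Option U := fun z => (some (min z.1 z.2), some (max z.1 z.2))
  have hinj : Set.InjOn e (S ×ˢ Y : Finset (U × U)) := by
    rintro ⟨x, y⟩ hx ⟨x', y'⟩ hx' hxy
    simp only [Finset.coe_product, Set.mem_prod, Finset.mem_coe] at hx hx'
    have d1 := Finset.disjoint_left.1 hSY hx.1
    have d2 := Finset.disjoint_left.1 hSY hx'.1
    simp only [e, Prod.mk.injEq, Option.some.injEq] at hxy
    rcases le_total x y with h1 | h1 <;> rcases le_total x' y' with h2 | h2 <;>
      simp [h1, h2] at hxy <;> grind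
  have h1 := h.measureReal_forall_not ((S ×ˢ Y).image e)
  rw [Finset.card_image_of_injOn hinj, Finset.card_product] at h1
  refine le_trans (measureReal_mono ?_) (h1.le.trans (pow_card_le hq0 hq1 hc))
  intro ω hω b hb
  obtain ⟨⟨x, y⟩, hxy, rfl⟩ := Finset.mem_image.1 hb
  rw [Finset.mem_product] at hxy
  exact hω x hxy.1 y hxy.2

/-- Closing the Hamilton paths of a fixed graph through `none`. -/
lemma measureReal_close [Fintype U] (h : IsBernoulliFamily ξ q μ) (hq0 : 0 ≤ q) (hq1 : q ≤ 1)
    {k : ℕ} {R : Finset U} {R' : U → Finset U} (hR : k < R.card)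
    (hR' : ∀ y ∈ R, k < (R' y).card) :
    μ.real {ω | ∀ y ∈ R, ∀ x ∈ R' y, ¬ (ξ (none, some x) ω ∧ ξ (some y, none) ω)} ≤
      (Fintype.card U + 1) * Real.exp (-(q * (k + 1 : ℕ))) := by
  classical
  have hsub : {ω | ∀ y ∈ R, ∀ x ∈ R' y, ¬ (ξ (none, some x) ω ∧ ξ (some y, none) ω)} ⊆
      {ω | ∀ y ∈ R, ¬ ξ (some y, none) ω} ∪
        ⋃ y ∈ R, {ω | ∀ x ∈ R' y, ¬ ξ (none, some x) ω} := by
    intro ω hω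
    by_cases hc : ∀ y ∈ R, ¬ ξ (some y, none) ω
    · exact Or.inl hc
    · push Not at hc
      obtain ⟨y, hy, hyξ⟩ := hc
      right
      simp only [Set.mem_iUnion]
      exact ⟨y, hy, fun x hx hxξ => hω y hy x hx ⟨hxξ, hyξ⟩⟩
  have h1 : μ.real {ω | ∀ y ∈ R, ¬ ξ (some y, none) ω} ≤ Real.exp (-(q * (k + 1 : ℕ))) :=
    ((h.precomp (g := fun y : U => (some y, none)) (by intro a b; simp)).measureReal_forall_not
      R).le.trans (pow_card_le hq0 hq1 hR)
  have h2 : ∀ y ∈ R, μ.real {ω | ∀ x ∈ R' y, ¬ ξ (none, some x) ω} ≤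
      Real.exp (-(q * (k + 1 : ℕ))) := fun y hy =>
    ((h.precomp (g := fun y : U => (none, some y)) (by intro a b; simp)).measureReal_forall_not
      (R' y)).le.trans (pow_card_le hq0 hq1 (hR' y hy))
  refine (measureReal_mono hsub).trans ((measureReal_union_le _ _).trans ?_)
  have h3 := (measureReal_biUnion_finset_le (μ := μ) R
    (fun y => {ω | ∀ x ∈ R' y, ¬ ξ (none, some x) ω})).trans (Finset.sum_le_sum h2)
  rw [Finset.sum_const, nsmul_eq_mul] at h3
  have h4 : (R.card : ℝ) ≤ Fintype.card U := by exact_mod_cast Finset.card_le_univ R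
  have h5 := mul_le_mul_of_nonneg_right h4 (Real.exp_nonneg (-(q * (k + 1 : ℕ))))
  linarith

end RandomGraph

/-! ### Hamiltonicity of sparse random graphs and closing a system of paths -/

section RandomHamilton

variable {U : Type*} [LinearOrder U] [Fintype U]
  {Ω : Type*} [MeasurableSpace Ω] {μ : Measure Ω} [IsProbabilityMeasure μ]
  {ξ : Option U × Option U → Ω → Prop} {q : ℝ}

lemma exp_neg_le_inv_pow {n : ℕ} (hn : 0 < n) {j : ℕ} {x : ℝ} (hx : j * Real.log n ≤ x) :
    Real.exp (-x) ≤ ((n : ℝ) ^ j)⁻¹ := by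
  have hn' : (0 : ℝ) < n := by exact_mod_cast hn
  calc Real.exp (-x) ≤ Real.exp (-(j * Real.log n)) := Real.exp_le_exp.2 (by linarith)
    _ = ((n : ℝ) ^ j)⁻¹ := by rw [Real.exp_neg, Real.exp_nat_mul, Real.exp_log hn']

/-- Non-expansion gives a set `S` of size `s` and a set `T` of size `2s + 2` containing its outside
neighbours, with no edge from `S` to the remaining vertices. There are at most n^(3s+2) ≤ n^(5s)
such pairs, and each has probability at most n^(-16s). -/
lemma measureReal_not_isExpander (h : IsBernoulliFamily ξ q μ) (hq0 : 0 ≤ q) (hq1 : q ≤ 1)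
    {n k : ℕ} (hU : 16 ≤ Fintype.card U) (hUn : Fintype.card U ≤ n) (hk : 8 * k ≤ Fintype.card U)
    (hq : 32 * Real.log n ≤ q * Fintype.card U) :
    μ.real {ω | ¬ IsExpander k (symmGraph fun e => ξ e ω)} ≤ ((n : ℝ) ^ 3)⁻¹ := by
  classical
  set M := Fintype.card U with hM
  have hn1 : (1 : ℝ) ≤ n := by exact_mod_cast (by omega : 1 ≤ n)
  have hn0 : (0 : ℝ) < n := by linarith
  have hlog : 0 ≤ Real.log n := Real.log_nonneg hn1
  have hsub : {ω | ¬ IsExpander k (symmGraph fun e => ξ e ω)} ⊆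
      ⋃ s ∈ Finset.Icc 1 k, ⋃ p ∈ Finset.powersetCard s (Finset.univ : Finset U) ×ˢ
        Finset.powersetCard (2 * s + 2) (Finset.univ : Finset U),
        {ω | ∀ x ∈ p.1, ∀ y ∈ (p.1 ∪ p.2)ᶜ, ¬ symmGraph (fun e => ξ e ω) x y} := by
    intro ω hω
    simp only [Set.mem_ofPred_eq, IsExpander, not_forall, not_le] at hω
    obtain ⟨S, hS, hSk, hlt⟩ := hω
    obtain ⟨T, hT, hTc⟩ := Finset.exists_superset_card_eq (n := 2 * S.card + 2)
      (s := Finset.univ.filter fun y => y ∉ S ∧ ∃ x ∈ S, symmGraph (fun e => ξ e ω) x y)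
      (by have : (Finset.univ.filter fun y => y ∉ S ∧ ∃ x ∈ S,
            symmGraph (fun e => ξ e ω) x y).card < 2 * S.card + 3 :=
              lt_of_eq_of_lt (by congr!) hlt
          omega)
      (by omega)
    simp only [Set.mem_iUnion]
    refine ⟨S.card, Finset.mem_Icc.2 ⟨hS.card_pos, hSk⟩, (S, T), by simp [hTc], ?_⟩
    intro x hx y hy hxy
    simp only [Finset.mem_compl, Finset.mem_union, not_or] at hy
    exact hy.2 (hT (by simpa using ⟨hy.1, x, hx, hxy⟩))
  have hterm : ∀ s ∈ Finset.Icc 1 k, ∀ p ∈ Finset.powersetCard s (Finset.univ : Finset U) ×ˢ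
        Finset.powersetCard (2 * s + 2) (Finset.univ : Finset U),
      μ.real {ω | ∀ x ∈ p.1, ∀ y ∈ (p.1 ∪ p.2)ᶜ, ¬ symmGraph (fun e => ξ e ω) x y} ≤
        ((n : ℝ) ^ (16 * s))⁻¹ := by
    rintro s hs ⟨S, T⟩ hST
    simp only [Finset.mem_product, Finset.mem_powersetCard, Finset.subset_univ, true_and] at hST
    rw [Finset.mem_Icc] at hs
    have hcard : M - (3 * s + 2) ≤ ((S ∪ T)ᶜ).card := by
      rw [Finset.card_compl]
      have := Finset.card_union_le S T
      omega
    refine (measureReal_no_edges h hq0 hq1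
      (Finset.disjoint_left.2 fun x hx hx' => by simp [hx] at hx')
      (Nat.mul_le_mul hST.1.ge hcard)).trans ?_
    refine exp_neg_le_inv_pow (by omega) ?_
    -- From 8s ≤ M and 16 ≤ M one gets 3s + 2 ≤ M/2.
    have h2 : (M : ℝ) ≤ 2 * (M - (3 * s + 2) : ℕ) := by
      exact_mod_cast (by omega : M ≤ 2 * (M - (3 * s + 2)))
    push_cast
    have h3 : 16 * Real.log n ≤ q * (M - (3 * s + 2) : ℕ) := by nlinarith
    have h4 := mul_le_mul_of_nonneg_left h3 (Nat.cast_nonneg s : (0 : ℝ) ≤ s)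
    nlinarith
  have hsum : ∀ s ∈ Finset.Icc 1 k,
      μ.real (⋃ p ∈ Finset.powersetCard s (Finset.univ : Finset U) ×ˢ
        Finset.powersetCard (2 * s + 2) (Finset.univ : Finset U),
        {ω | ∀ x ∈ p.1, ∀ y ∈ (p.1 ∪ p.2)ᶜ, ¬ symmGraph (fun e => ξ e ω) x y}) ≤
        ((n : ℝ) ^ 11)⁻¹ := by
    intro s hs
    refine (measureReal_biUnion_finset_le _ _).trans ((Finset.sum_le_sum (hterm s hs)).trans ?_)
    rw [Finset.sum_const, nsmul_eq_mul, Finset.card_product, Finset.card_powersetCard,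
      Finset.card_powersetCard, Finset.card_univ, ← hM]
    rw [Finset.mem_Icc] at hs
    have hc : M.choose s * M.choose (2 * s + 2) ≤ n ^ (5 * s) := by
      calc M.choose s * M.choose (2 * s + 2) ≤ M ^ s * M ^ (2 * s + 2) :=
            Nat.mul_le_mul (Nat.choose_le_pow _ _) (Nat.choose_le_pow _ _)
        _ = M ^ (3 * s + 2) := by rw [← pow_add]; congr 1; ring
        _ ≤ n ^ (3 * s + 2) := Nat.pow_le_pow_left hUn _
        _ ≤ n ^ (5 * s) := Nat.pow_le_pow_right (by omega) (by omega)
    have hc' : ((M.choose s * M.choose (2 * s + 2) : ℕ) : ℝ) ≤ (n : ℝ) ^ (5 * s) := by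
      exact_mod_cast hc
    refine (mul_le_mul_of_nonneg_right hc' (by positivity)).trans ?_
    rw [← div_eq_mul_inv, div_le_iff₀ (by positivity), inv_mul_eq_div, le_div_iff₀ (by positivity),
      ← pow_add]
    exact pow_le_pow_right₀ hn1 (by omega)
  refine (measureReal_mono hsub (measure_ne_top _ _)).trans
    ((measureReal_biUnion_finset_le _ _).trans ((Finset.sum_le_sum hsum).trans ?_))
  rw [Finset.sum_const, nsmul_eq_mul, Nat.card_Icc, Nat.add_sub_cancel]
  have hkn : (k : ℝ) ≤ n := by exact_mod_cast (by omega : k ≤ n)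
  rw [← div_eq_mul_inv, div_le_iff₀ (by positivity), inv_mul_eq_div, le_div_iff₀ (by positivity)]
  calc (k : ℝ) * n ^ 3 ≤ n * n ^ 3 := mul_le_mul_of_nonneg_right hkn (by positivity)
    _ = (n : ℝ) ^ 4 := by ring
    _ ≤ (n : ℝ) ^ 11 := pow_le_pow_right₀ hn1 (by norm_num)

/-- Three things can fail: expansion, the adjacency of some `w` to the ends of longest paths
avoiding it, and the closing of the Hamilton paths through `none`. The vertex `none` stays outside
the graph in which paths are rotated, so its arcs are independent of the ends to be joined. -/
lemma measureReal_not_hasCycleThrough (h : IsBernoulliFamily ξ q μ) (hq0 : 0 ≤ q) (hq1 : q ≤ 1)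
    {n : ℕ} (hU : 16 ≤ Fintype.card U) (hUn : Fintype.card U ≤ n)
    (hq : 32 * Real.log n ≤ q * Fintype.card U) :
    μ.real {ω | ¬ HasCycleThrough (∅ : Finset (U × U)) (fun e => ξ e ω)} ≤
      4 * ((n : ℝ) ^ 3)⁻¹ := by
  classical
  set M := Fintype.card U with hM
  -- Small enough for expansion, and with q(k + 1) ≥ 4 log n, so that an error of n⁻⁴ survives the
  -- union over all vertices.
  let k := M / 8
  have hn1 : (1 : ℝ) ≤ n := by exact_mod_cast (by omega : 1 ≤ n)
  have hn0 : (0 : ℝ) < n := by linarith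
  have hexp : Real.exp (-(q * (k + 1 : ℕ))) ≤ ((n : ℝ) ^ 4)⁻¹ := by
    refine exp_neg_le_inv_pow (by omega) ?_
    have : (M : ℝ) ≤ 8 * (k + 1 : ℕ) := by exact_mod_cast (by omega : M ≤ 8 * (k + 1))
    push_cast at this ⊢
    nlinarith
  have : Nontrivial U := Fintype.one_lt_card_iff_nontrivial.1 (by omega)
  let nice : (Option U × Option U → Prop) → Prop := fun f =>
    IsExpander k (symmGraph f) ∧ ∀ w, ∃ x ∈ avoidingEnds (symmGraph f) w, symmGraph f w x
  let closes : (Option U × Option U → Prop) → (Option U × Option U → Prop) → Prop := fun f g =>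
    ∃ (l : List U) (x y : U), l.Nodup ∧ (∀ u, u ∈ l) ∧ l.IsChain (symmGraph f) ∧
      l.head? = some x ∧ l.getLast? = some y ∧ g (none, some x) ∧ g (some y, none)
  have hsub : {ω | ¬ HasCycleThrough (∅ : Finset (U × U)) (fun e => ξ e ω)} ⊆
      ({ω | ¬ IsExpander k (symmGraph fun e => ξ e ω)} ∪
      ⋃ w ∈ (Finset.univ : Finset U),
        {ω | k < (avoidingEnds (symmGraph fun e => ξ e ω) w).card ∧
        ∀ x ∈ avoidingEnds (symmGraph fun e => ξ e ω) w, ¬ symmGraph (fun e => ξ e ω) w x}) ∪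
      {ω | nice (fun e => ξ e ω) ∧ ¬ closes (fun e => ξ e ω) (fun e => ξ e ω)} := by
    intro ω hω
    by_cases h1 : IsExpander k (symmGraph fun e => ξ e ω)
    · by_cases h2 : ∀ w, ∃ x ∈ avoidingEnds (symmGraph fun e => ξ e ω) w,
          symmGraph (fun e => ξ e ω) w x
      · refine Or.inr ⟨⟨h1, h2⟩, ?_⟩
        rintro ⟨l, x, y, a1, a2, a3, a4, a5, a6, a7⟩
        exact hω (hasCycleThrough_empty_of_path a1 a2 a3 a4 a5 a6 a7)
      · push Not at h2
        obtain ⟨w, hw⟩ := h2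
        obtain ⟨v, hv⟩ := exists_ne w
        refine Or.inl (Or.inr ?_)
        simp only [Set.mem_iUnion]
        exact ⟨w, Finset.mem_univ w, h1.lt_card_avoidingEnds (symmGraph_symm _) hv, hw⟩
    · exact Or.inl (Or.inl h1)
  have hb1 := measureReal_not_isExpander h hq0 hq1 hU hUn (k := k)
    (by have := Nat.div_mul_le_self M 8; omega) hq
  have hb2 := (measureReal_biUnion_finset_le (μ := μ) (Finset.univ : Finset U)
    (fun w => {ω | k < (avoidingEnds (symmGraph fun e => ξ e ω) w).card ∧
        ∀ x ∈ avoidingEnds (symmGraph fun e => ξ e ω) w, ¬ symmGraph (fun e => ξ e ω) w x})).trans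
    (Finset.sum_le_sum fun w _ => measureReal_avoidingEnds h hq0 hq1 k w)
  rw [Finset.sum_const, nsmul_eq_mul, Finset.card_univ, ← hM] at hb2
  have hb3 : μ.real {ω | nice (fun e => ξ e ω) ∧ ¬ closes (fun e => ξ e ω) (fun e => ξ e ω)} ≤
      (M + 1) * Real.exp (-(q * (k + 1 : ℕ))) := by
    refine measureReal_decouple_le h.measurable h.indep
      {e | e.1 = none ∨ e.2 = none} (fun f g => nice f ∧ ¬ closes f g) ?_ ?_
    · intro f f' g g' hf hg
      have e : symmGraph f = symmGraph f' := by
        ext u v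
        have := hf (some (min u v), some (max u v)) (by simp)
        simp [symmGraph, this]
      have e1 : ∀ x : U, g (none, some x) = g' (none, some x) := fun x => hg _ (by simp)
      have e2 : ∀ x : U, g (some x, none) = g' (some x, none) := fun x => hg _ (by simp)
      have e' : ∀ u v, symmGraph f u v = symmGraph f' u v := fun u v => by rw [e]
      simp only [nice, closes, e, e', e1, e2]
      exact id
    · intro f
      by_cases hf : nice f
      · obtain ⟨R, R', hR, hR'⟩ := hf.1.exists_hamilton_ends (symmGraph_symm f) hf.2
        refine le_trans (measureReal_mono ?_)
          (measureReal_close h hq0 hq1 hR fun y hy => (hR' y hy).1)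
        rintro ω ⟨-, hω⟩ y hy x hx ⟨hxy1, hxy2⟩
        obtain ⟨l, a1, a2, a3, a4, a5⟩ := (hR' y hy).2 x hx
        exact hω ⟨l, x, y, a1, a2, a3, a4, a5, hxy1, hxy2⟩
      · simp only [hf, false_and]
        simp only [Set.ofPred_false, measureReal_empty]
        positivity
  refine (measureReal_mono hsub).trans ((measureReal_union_le _ _).trans
    (add_le_add ((measureReal_union_le _ _).trans (add_le_add hb1 hb2)) hb3 |>.trans ?_))
  have hMn : (M : ℝ) ≤ n := by exact_mod_cast hUn
  have hinv : (n : ℝ) * ((n : ℝ) ^ 4)⁻¹ = ((n : ℝ) ^ 3)⁻¹ := by field_simp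
  have hinv4 : ((n : ℝ) ^ 4)⁻¹ ≤ ((n : ℝ) ^ 3)⁻¹ :=
    inv_anti₀ (by positivity) (pow_le_pow_right₀ hn1 (by norm_num))
  have h1 : (M : ℝ) * Real.exp (-(q * (k + 1 : ℕ))) ≤ n * ((n : ℝ) ^ 4)⁻¹ :=
    mul_le_mul hMn hexp (Real.exp_nonneg _) hn0.le
  have h2 : ((M : ℝ) + 1) * Real.exp (-(q * (k + 1 : ℕ))) ≤ (n + 1) * ((n : ℝ) ^ 4)⁻¹ :=
    mul_le_mul (by linarith) hexp (Real.exp_nonneg _) (by linarith)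
  linarith

/-- A cyclic list of all vertices yields a cyclic permutation along arcs. -/
lemma exists_perm_of_isHamiltonPath {f : Option U × Option U → Prop} {l : List U}
    (hl : IsHamiltonPath (fun u v => f (some u, some v)) (fun u => f (none, some u))
      (fun u => f (some u, none)) l) :
    ∃ ρ : Equiv.Perm (Option U), (∀ x, f (x, ρ x)) ∧ ∀ x y, ∃ t : ℕ, (ρ ^ t) x = y := by
  obtain ⟨h1, h2, h3, ⟨x, hx, hAx⟩, y, hy, hBy⟩ := hl
  let cyc : List (Option U) := none :: l.map some
  have hc : cyc.Nodup := List.nodup_cons.2 ⟨by simp, h1.map (Option.some_injective _)⟩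
  have hall : ∀ u, u ∈ cyc := by
    rintro (_ | u)
    · simp [cyc]
    · simp [cyc, h2 u]
  have hchain : cyc.IsChain (fun u v => f (u, v)) := by
    refine List.IsChain.cons ?_ ?_
    · rw [List.isChain_map]; exact h3
    · intro z hz
      simp [hx] at hz
      subst hz
      exact hAx
  refine ⟨cyc.formPerm, fun z => ?_, fun z z' => ?_⟩
  · obtain ⟨i, hi, rfl⟩ := List.getElem_of_mem (hall z)
    rw [List.formPerm_apply_getElem _ hc]
    by_cases hi' : i + 1 < cyc.length
    · simp only [Nat.mod_eq_of_lt hi']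
      exact List.isChain_iff_getElem.1 hchain i hi'
    · have hi2 : i + 1 = cyc.length := by omega
      simp only [hi2, Nat.mod_self]
      have hlast : cyc[i] = some y := by
        have : cyc.getLast? = some (some y) := by
          simp [cyc, List.getLast?_cons, hy]
        rw [List.getLast?_eq_getElem?, ← hi2, Nat.add_sub_cancel] at this
        rw [List.getElem?_eq_getElem hi] at this
        simpa using this
      rw [hlast]
      exact hBy
  · obtain ⟨t, ht⟩ := (hc.isCycleOn_formPerm).exists_pow_eq' (Set.toFinite _)
      (show z ∈ {a | a ∈ cyc} from hall z) (show z' ∈ {a | a ∈ cyc} from hall z')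
    exact ⟨t, ht⟩

/-- In a sparse random bipartite graph between two copies of `Fin m` there is a perfect matching
that closes up the fixed bijection `σ` to a single cycle, with high probability. -/
theorem measureReal_not_exists_cyclic {m n : ℕ} {ξ : Fin m × Fin m → Ω → Prop}
    (h : IsBernoulliFamily ξ q μ) (hq0 : 0 ≤ q) (hq1 : q ≤ 1) (hm : 17 ≤ m) (hmn : m ≤ n)
    (hq : 64 * Real.log n ≤ q * m) (σ : Equiv.Perm (Fin m)) :
    μ.real {ω | ¬ ∃ τ : Equiv.Perm (Fin m), (∀ x, ξ (x, τ x) ω) ∧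
      ∀ x y, ∃ t : ℕ, ((τ * σ) ^ t) x = y} ≤ 4 * ((n : ℝ) ^ 3)⁻¹ := by
  obtain ⟨M, rfl⟩ : ∃ M, m = M + 1 := ⟨m - 1, by omega⟩
  let e : Fin (M + 1) ≃ Option (Fin M) := finSuccEquiv M
  -- Contract each path: an arc from `u` to `v` in `ζ` stands for the closing arc from the end `σ u`
  -- of the path starting at `u` to the start `v`. A Hamilton cycle `ρ` of `ζ` corresponds to `τ = ρ
  -- * σ⁻¹`.
  let ζ : Option (Fin M) × Option (Fin M) → Ω → Prop := fun z => ξ (σ (e.symm z.1), e.symm z.2)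
  have hζ : IsBernoulliFamily ζ q μ := by
    refine h.precomp (g := fun z : Option (Fin M) × Option (Fin M) =>
      (σ (e.symm z.1), e.symm z.2)) ?_
    rintro ⟨a, b⟩ ⟨a', b'⟩ hab
    simpa using hab
  have hq' : 32 * Real.log n ≤ q * Fintype.card (Fin M) := by
    rw [Fintype.card_fin]
    have : (16 : ℝ) ≤ M := by exact_mod_cast (by omega : 16 ≤ M)
    push_cast at hq
    nlinarith
  have h1 := measureReal_not_hasCycleThrough hζ hq0 hq1 (by simp; omega) (by simp; omega) hq'
  have hmeas : ∀ P : (Option (Fin M) × Option (Fin M) → Prop) → Prop,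
      MeasurableSet {ω | P fun e => ζ e ω} := by
    intro P
    have : Measurable (fun ω e => ζ e ω) := measurable_pi_lambda _ hζ.measurable
    exact this (.of_discrete (s := {f | P f}))
  have h2 := hasCycleThrough_mcdiarmid hζ
  let E := {ω | ∃ l : List (Fin M), IsHamiltonPath (fun u v => ζ (some u, some v) ω)
        (fun u => ζ (none, some u) ω) (fun u => ζ (some u, none) ω) l}
  have h3 : μ.real Eᶜ ≤ 4 * ((n : ℝ) ^ 3)⁻¹ := by
    have e1 := probReal_compl_eq_one_sub (μ := μ) (hmeas fun f => ∃ l : List (Fin M),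
      IsHamiltonPath (fun u v => f (some u, some v)) (fun u => f (none, some u))
        (fun u => f (some u, none)) l)
    have e2 := probReal_compl_eq_one_sub (μ := μ)
      (hmeas fun f => HasCycleThrough (∅ : Finset (Fin M × Fin M)) f)
    have e3 : {ω | HasCycleThrough (∅ : Finset (Fin M × Fin M)) fun e => ζ e ω}ᶜ =
      {ω | ¬ HasCycleThrough (∅ : Finset (Fin M × Fin M)) fun e => ζ e ω} := rfl
    rw [e3] at e2
    have : μ.real Eᶜ = 1 - μ.real E := e1
    rw [this]
    linarith
  refine le_trans (measureReal_mono ?_) h3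
  intro ω hω hE
  obtain ⟨l, hl⟩ := hE
  obtain ⟨ρ, hρ1, hρ2⟩ := exists_perm_of_isHamiltonPath (f := fun z => ζ z ω) hl
  let ρ' : Equiv.Perm (Fin (M + 1)) := (e.trans ρ).trans e.symm
  have hpow : ∀ (t : ℕ) x, (ρ' ^ t) x = e.symm ((ρ ^ t) (e x)) := by
    intro t
    induction t with
    | zero => simp
    | succ t ih => intro x; rw [pow_succ', pow_succ', Equiv.Perm.mul_apply, ih]; simp [ρ']
  refine hω ⟨ρ' * σ⁻¹, fun x => ?_, fun x y => ?_⟩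
  · have := hρ1 (e (σ⁻¹ x))
    simpa [ζ, ρ'] using this
  · obtain ⟨t, ht⟩ := hρ2 (e x) (e y)
    exact ⟨t, by rw [inv_mul_cancel_right, hpow, ht]; simp⟩

end RandomHamilton

/-! ### Regular factors and disjoint perfect matchings in bipartite graphs -/

section Factor

variable {Z : Type*} [DecidableEq Z]

lemma card_filter_fst (F : Finset (Z × Z)) (A : Finset Z) :
    (F.filter fun e => e.1 ∈ A).card = ∑ a ∈ A, (F.filter fun e => e.1 = a).card := by
  rw [Finset.card_eq_sum_card_fiberwise (f := Prod.fst) (t := A) (by intro e he; simp_all)]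
  refine Finset.sum_congr rfl fun a ha => ?_
  rw [Finset.filter_filter]
  congr 1
  ext e
  simp only [Finset.mem_filter]
  constructor
  · rintro ⟨h1, h2, h3⟩; exact ⟨h1, h3⟩
  · rintro ⟨h1, rfl⟩; exact ⟨h1, ha, rfl⟩

lemma card_filter_snd (F : Finset (Z × Z)) (A : Finset Z) :
    (F.filter fun e => e.2 ∈ A).card = ∑ a ∈ A, (F.filter fun e => e.2 = a).card := by
  rw [Finset.card_eq_sum_card_fiberwise (f := Prod.snd) (t := A) (by intro e he; simp_all)]
  refine Finset.sum_congr rfl fun a ha => ?_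
  rw [Finset.filter_filter]
  congr 1
  ext e
  simp only [Finset.mem_filter]
  constructor
  · rintro ⟨h1, h2, h3⟩; exact ⟨h1, h3⟩
  · rintro ⟨h1, rfl⟩; exact ⟨h1, ha, rfl⟩

variable [Fintype Z]

/-- A regular bipartite graph decomposes into perfect matchings. -/
theorem exists_perms_of_regular (r : ℕ) (F : Finset (Z × Z))
    (h1 : ∀ x, (F.filter fun e => e.1 = x).card = r)
    (h2 : ∀ y, (F.filter fun e => e.2 = y).card = r) :
    ∃ f : Fin r → Equiv.Perm Z, (∀ i x, (x, f i x) ∈ F) ∧ ∀ i j x, f i x = f j x → i = j := by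
  induction r generalizing F with
  | zero => exact ⟨fun i => i.elim0, fun i => i.elim0, fun i => i.elim0⟩
  | succ r ih =>
    -- Hall's condition by double counting: the `r + 1` edges at each vertex of `A` all end in the
    -- neighbourhood of `A`, where each vertex has degree `r + 1`.
    have hall : ∀ A : Finset Z, A.card ≤
        (Finset.univ.filter fun b => ∃ a ∈ A, (a, b) ∈ F).card := by
      intro A
      have hsub : (F.filter fun e => e.1 ∈ A) ⊆
          F.filter fun e => e.2 ∈ Finset.univ.filter fun b => ∃ a ∈ A, (a, b) ∈ F := by
        intro e he
        simp only [Finset.mem_filter, Finset.mem_univ, true_and] at he ⊢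
        exact ⟨he.1, e.1, he.2, he.1⟩
      have := Finset.card_le_card hsub
      rw [card_filter_fst, card_filter_snd] at this
      simp only [h1, h2, Finset.sum_const, smul_eq_mul] at this
      exact Nat.le_of_mul_le_mul_right this (Nat.succ_pos r)
    obtain ⟨g, hg, hgF⟩ := (Fintype.all_card_le_filter_rel_iff_exists_injective
      (fun a b => (a, b) ∈ F)).1 hall
    let π : Equiv.Perm Z := Equiv.ofBijective g (Finite.injective_iff_bijective.1 hg)
    let P : Finset (Z × Z) := Finset.univ.image fun x => (x, g x)
    have hPF : P ⊆ F := by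
      intro e he
      obtain ⟨x, -, rfl⟩ := Finset.mem_image.1 he
      exact hgF x
    have d1 : ∀ x, ((F \ P).filter fun e => e.1 = x).card = r := by
      intro x
      have e : ((F \ P).filter fun e => e.1 = x) = (F.filter fun e => e.1 = x).erase (x, g x) := by
        ext ⟨a, b⟩
        simp only [P, Finset.mem_filter, Finset.mem_sdiff, Finset.mem_image, Finset.mem_univ,
          true_and, Finset.mem_erase, Prod.mk.injEq]
        grind
      rw [e, Finset.card_erase_of_mem (by simpa using hgF x), h1, Nat.add_sub_cancel]
    have d2 : ∀ y, ((F \ P).filter fun e => e.2 = y).card = r := by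
      intro y
      have e : ((F \ P).filter fun e => e.2 = y) =
          (F.filter fun e => e.2 = y).erase (π.symm y, y) := by
        have hy : g (π.symm y) = y := π.apply_symm_apply y
        ext ⟨a, b⟩
        simp only [P, Finset.mem_filter, Finset.mem_sdiff, Finset.mem_image, Finset.mem_univ,
          true_and, Finset.mem_erase, Prod.mk.injEq]
        grind
      have hy : (π.symm y, y) ∈ F := by
        have := hgF (π.symm y)
        rwa [show g (π.symm y) = y from π.apply_symm_apply y] at this
      rw [e, Finset.card_erase_of_mem (by simpa using hy), h2, Nat.add_sub_cancel]
    obtain ⟨f, hf1, hf2⟩ := ih (F \ P) d1 d2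
    · refine ⟨Fin.cons π f, ?_, ?_⟩
      · intro i x
        refine Fin.cases ?_ (fun i => ?_) i
        · exact hgF x
        · exact (Finset.mem_sdiff.1 (hf1 i x)).1
      · have hne : ∀ i x, f i x ≠ g x := fun i x hc =>
          (Finset.mem_sdiff.1 (hf1 i x)).2 (Finset.mem_image.2 ⟨x, Finset.mem_univ _, by rw [hc]⟩)
        intro i j x
        refine Fin.cases ?_ (fun i => ?_) i <;> refine Fin.cases ?_ (fun j => ?_) j
        · simp
        · intro h; exact absurd h.symm (hne j x)
        · intro h; exact absurd h (hne i x)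
        · intro h; exact congrArg Fin.succ (hf2 i j x h)

open Classical in
/-- The neighbourhoods of the auxiliary bipartite graph whose perfect matchings are the
`r`-factors of `E`: the edges on both sides, with surplus vertices that absorb unused edges. -/
noncomputable def gadget (E : Finset (Z × Z)) (r : ℕ) :
    ({e // e ∈ E} ⊕ Σ y : Z, Fin ((E.filter fun e => e.2 = y).card - r)) →
    Finset ({e // e ∈ E} ⊕ Σ x : Z, Fin ((E.filter fun e => e.1 = x).card - r)) :=
  fun a => Finset.univ.filter fun b =>
    match a, b with
    | .inl e, .inl e' => e = e'
    | .inl e, .inr c => c.1 = e.1.1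
    | .inr c, .inl e' => e'.1.2 = c.1
    | .inr _, .inr _ => False

/-- Let S be the first endpoints of the edges in `A` and T the vertices whose surplus copies occur
in `A`. The neighbourhood contains the right copies of the edges in `A` and of all edges into T, and
every surplus copy over S. The two kinds of right copies overlap in at most e(S, T) edges, and what
remains to check is r|S| - r|T| ≤ e(S, Tᶜ), which is the hypothesis for S and Tᶜ. -/
lemma gadget_hall (E : Finset (Z × Z)) (r : ℕ)
    (hE : ∀ S T : Finset Z, r * (S.card + T.card) ≤
      (E.filter fun e => e.1 ∈ S ∧ e.2 ∈ T).card + r * Fintype.card Z)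
    (hd1 : ∀ x, r ≤ (E.filter fun e => e.1 = x).card)
    (hd2 : ∀ y, r ≤ (E.filter fun e => e.2 = y).card)
    (A : Finset ({e // e ∈ E} ⊕ Σ y : Z, Fin ((E.filter fun e => e.2 = y).card - r))) :
    A.card ≤ (A.biUnion (gadget E r)).card := by
  classical
  let T : Finset Z := A.toRight.image Sigma.fst
  let S : Finset Z := A.toLeft.image fun e => e.1.1
  let ET : Finset {e // e ∈ E} := Finset.univ.filter fun e => e.1.2 ∈ T
  have hR : A.toRight.card ≤ ∑ y ∈ T, ((E.filter fun e => e.2 = y).card - r) := by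
    have : A.toRight ⊆ T.sigma fun _ => Finset.univ := by
      intro c hc
      simp only [Finset.mem_sigma, Finset.mem_univ, and_true]
      exact Finset.mem_image_of_mem _ hc
    refine (Finset.card_le_card this).trans (le_of_eq ?_)
    simp [Finset.card_sigma]
  have hBl : A.toLeft ∪ ET ⊆ (A.biUnion (gadget E r)).toLeft := by
    intro e he
    rw [Finset.mem_toLeft, Finset.mem_biUnion]
    rcases Finset.mem_union.1 he with he | he
    · exact ⟨.inl e, Finset.mem_toLeft.1 he, by simp [gadget]⟩
    · simp only [ET, T, Finset.mem_filter, Finset.mem_univ, true_and, Finset.mem_image] at he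
      obtain ⟨c, hc, hce⟩ := he
      exact ⟨.inr c, Finset.mem_toRight.1 hc, by simp [gadget, hce]⟩
  have hBr : (S.sigma fun _ => Finset.univ) ⊆ (A.biUnion (gadget E r)).toRight := by
    rintro ⟨x, i⟩ hx
    rw [Finset.mem_toRight, Finset.mem_biUnion]
    simp only [S, Finset.mem_sigma, Finset.mem_image, Finset.mem_univ, and_true] at hx
    obtain ⟨e, he, rfl⟩ := hx
    exact ⟨.inl e, Finset.mem_toLeft.1 he, by simp [gadget]⟩
  have cBl := Finset.card_le_card hBl
  have cBr := Finset.card_le_card hBr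
  rw [Finset.card_sigma] at cBr
  simp only [Finset.card_univ, Fintype.card_fin] at cBr
  have hET : ET.card = ∑ y ∈ T, (E.filter fun e => e.2 = y).card := by
    rw [← card_filter_snd, ← Finset.card_image_of_injective ET Subtype.val_injective]
    congr 1
    ext e
    simp [ET, and_comm]
  have hinter : (A.toLeft ∩ ET).card ≤ (E.filter fun e => e.1 ∈ S ∧ e.2 ∈ T).card := by
    rw [← Finset.card_image_of_injective _ Subtype.val_injective]
    refine Finset.card_le_card fun e he => ?_
    obtain ⟨e, he', rfl⟩ := Finset.mem_image.1 he
    rw [Finset.mem_inter] at he'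
    rw [Finset.mem_filter]
    exact ⟨e.2, Finset.mem_image_of_mem _ he'.1, (Finset.mem_filter.1 he'.2).2⟩
  have hS : (E.filter fun e => e.1 ∈ S ∧ e.2 ∈ T).card +
      (E.filter fun e => e.1 ∈ S ∧ e.2 ∈ Tᶜ).card = ∑ x ∈ S, (E.filter fun e => e.1 = x).card := by
    rw [← card_filter_fst, ← Finset.card_filter_add_card_filter_not (p := fun e => e.2 ∈ T)
      (s := E.filter fun e => e.1 ∈ S), Finset.filter_filter, Finset.filter_filter]
    simp only [Finset.mem_compl]
  have hST := hE S Tᶜ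
  have hTc := Finset.card_compl_add_card T
  have t1 : ∑ x ∈ S, ((E.filter fun e => e.1 = x).card - r) + S.card * r =
      ∑ x ∈ S, (E.filter fun e => e.1 = x).card := by
    rw [← smul_eq_mul, ← Finset.sum_const, ← Finset.sum_add_distrib]
    exact Finset.sum_congr rfl fun x _ => Nat.sub_add_cancel (hd1 x)
  have t2 : ∑ x ∈ T, ((E.filter fun e => e.2 = x).card - r) + T.card * r =
      ∑ x ∈ T, (E.filter fun e => e.2 = x).card := by
    rw [← smul_eq_mul, ← Finset.sum_const, ← Finset.sum_add_distrib]
    exact Finset.sum_congr rfl fun x _ => Nat.sub_add_cancel (hd2 x)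
  have hunion := Finset.card_union_add_card_inter A.toLeft ET
  have hA := Finset.card_toLeft_add_card_toRight (u := A)
  have hB := Finset.card_toLeft_add_card_toRight (u := A.biUnion (gadget E r))
  rw [← hTc] at hST
  have : r * (S.card + Tᶜ.card) = S.card * r + Tᶜ.card * r := by ring
  have : r * (Tᶜ.card + T.card) = Tᶜ.card * r + T.card * r := by ring
  omega

/-- In a perfect matching of the gadget, keep the edges whose two copies are matched to each other.
The left copy of a discarded edge takes a surplus copy of its first endpoint, and its right copy one
of its second endpoint. All surplus copies are used, so each vertex loses exactly its degree minus
`r`. -/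
theorem exists_regular_subgraph (E : Finset (Z × Z)) (r : ℕ)
    (hE : ∀ S T : Finset Z, r * (S.card + T.card) ≤
      (E.filter fun e => e.1 ∈ S ∧ e.2 ∈ T).card + r * Fintype.card Z) :
    ∃ F ⊆ E, (∀ x, (F.filter fun e => e.1 = x).card = r) ∧
      ∀ y, (F.filter fun e => e.2 = y).card = r := by
  have hd1 : ∀ x, r ≤ (E.filter fun e => e.1 = x).card := by
    intro x
    have := hE {x} Finset.univ
    simp only [Finset.card_singleton, Finset.card_univ, Finset.mem_singleton, Finset.mem_univ,
      and_true, mul_add, mul_one] at this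
    omega
  have hd2 : ∀ y, r ≤ (E.filter fun e => e.2 = y).card := by
    intro y
    have := hE Finset.univ {y}
    simp only [Finset.card_singleton, Finset.card_univ, Finset.mem_singleton, Finset.mem_univ,
      true_and, mul_add, mul_one] at this
    omega
  obtain ⟨φ, hφ, hφt⟩ := (Finset.all_card_le_biUnion_card_iff_exists_injective (gadget E r)).1
    (gadget_hall E r hE hd1 hd2)
  -- Both sides have 2|E| - r|Z| vertices, so a matching that covers one side is perfect.
  have hcard : Fintype.card ({e // e ∈ E} ⊕ Σ y : Z, Fin ((E.filter fun e => e.2 = y).card - r)) =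
      Fintype.card ({e // e ∈ E} ⊕ Σ x : Z, Fin ((E.filter fun e => e.1 = x).card - r)) := by
    simp only [Fintype.card_sum, Fintype.card_sigma, Fintype.card_fin]
    congr 1
    have s1 := card_filter_fst E Finset.univ
    have s2 := card_filter_snd E Finset.univ
    simp only [Finset.mem_univ, Finset.filter_true] at s1 s2
    have t1 : ∑ x : Z, ((E.filter fun e => e.1 = x).card - r) + ∑ x : Z, r = E.card := by
      rw [s1, ← Finset.sum_add_distrib]
      exact Finset.sum_congr rfl fun x _ => Nat.sub_add_cancel (hd1 x)
    have t2 : ∑ x : Z, ((E.filter fun e => e.2 = x).card - r) + ∑ x : Z, r = E.card := by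
      rw [s2, ← Finset.sum_add_distrib]
      exact Finset.sum_congr rfl fun x _ => Nat.sub_add_cancel (hd2 x)
    omega
  have hsurj : Function.Surjective φ := ((Fintype.bijective_iff_injective_and_card φ).2
    ⟨hφ, hcard⟩).2
  -- what the matching does
  have m1 : ∀ e, φ (.inl e) = .inl e ∨ ∃ i, φ (.inl e) = .inr ⟨e.1.1, i⟩ := by
    intro e
    have := hφt (.inl e)
    rcases hz : φ (.inl e) with e' | ⟨x, i⟩
    · rw [hz] at this; simp [gadget] at this; left; rw [this]
    · rw [hz] at this; simp [gadget] at this; subst this; exact Or.inr ⟨i, rfl⟩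
  have m2 : ∀ y i, ∃ e, e.1.2 = y ∧ φ (.inr ⟨y, i⟩) = .inl e := by
    intro y i
    have := hφt (.inr ⟨y, i⟩)
    rcases hz : φ (.inr ⟨y, i⟩) with e' | c
    · rw [hz] at this; simp [gadget] at this; exact ⟨e', this, rfl⟩
    · rw [hz] at this; simp [gadget] at this
  classical
  let N : Finset {e // e ∈ E} := Finset.univ.filter fun e => φ (.inl e) ≠ .inl e
  let F : Finset (Z × Z) := E.filter fun e => ∀ h : e ∈ E, φ (.inl ⟨e, h⟩) = .inl ⟨e, h⟩
  have hN1 : ∀ x, (N.filter fun e => e.1.1 = x).card = (E.filter fun e => e.1 = x).card - r := by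
    intro x
    have key : (N.filter fun e => e.1.1 = x).image (fun e => φ (.inl e)) =
        Finset.univ.image fun i : Fin ((E.filter fun e => e.1 = x).card - r) =>
          (Sum.inr ⟨x, i⟩ : {e // e ∈ E} ⊕ Σ x : Z, Fin ((E.filter fun e => e.1 = x).card - r)) := by
      ext z
      simp only [N, Finset.mem_image, Finset.mem_filter, Finset.mem_univ, true_and]
      constructor
      · rintro ⟨e, ⟨h1, rfl⟩, rfl⟩
        rcases m1 e with h | ⟨i, h⟩
        · exact absurd h h1
        · exact ⟨i, h.symm⟩
      · rintro ⟨i, rfl⟩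
        obtain ⟨a | ⟨y, j⟩, ha⟩ := hsurj (.inr ⟨x, i⟩)
        · refine ⟨a, ⟨?_, ?_⟩, ha⟩
          · rw [ha]; simp
          · rcases m1 a with h | ⟨i', h⟩
            · rw [h] at ha; simp at ha
            · rw [h] at ha; simp at ha; exact ha.1
        · obtain ⟨e, _, he⟩ := m2 y j
          rw [he] at ha; simp at ha
    have c := congrArg Finset.card key
    rw [Finset.card_image_of_injective _ (fun a b hab => Sum.inl_injective (hφ hab)),
      Finset.card_image_of_injective _ (fun a b hab => by simpa using hab), Finset.card_univ,
      Fintype.card_fin] at c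
    exact c
  have hN2 : ∀ y, (N.filter fun e => e.1.2 = y).card = (E.filter fun e => e.2 = y).card - r := by
    intro y
    have key : (Finset.univ.image fun i : Fin ((E.filter fun e => e.2 = y).card - r) =>
          φ (.inr ⟨y, i⟩)) = (N.filter fun e => e.1.2 = y).image Sum.inl := by
      ext z
      simp only [N, Finset.mem_image, Finset.mem_filter, Finset.mem_univ, true_and]
      constructor
      · rintro ⟨i, rfl⟩
        obtain ⟨e, he, he'⟩ := m2 y i
        refine ⟨e, ⟨fun h => ?_, he⟩, he'.symm⟩
        have := hφ (h.trans he'.symm)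
        simp at this
      · rintro ⟨e, ⟨h1, h2⟩, rfl⟩
        obtain ⟨a | ⟨y', j⟩, ha⟩ := hsurj (.inl e)
        · rcases m1 a with h | ⟨i', h⟩
          · rw [h] at ha; simp at ha; subst ha; exact absurd h h1
          · rw [h] at ha; simp at ha
        · obtain ⟨e', h3, h4⟩ := m2 y' j
          rw [h4] at ha; simp at ha; subst ha
          have : y = y' := h2.symm.trans h3
          subst this
          exact ⟨j, h4⟩
    have c := congrArg Finset.card key
    rw [Finset.card_image_of_injective _ Sum.inl_injective,
      Finset.card_image_of_injective _ (fun a b hab => by simpa using hφ hab), Finset.card_univ,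
      Fintype.card_fin] at c
    exact c.symm
  have hsplit : ∀ P : Z × Z → Prop, ∀ [DecidablePred P],
      (F.filter P).card + (N.filter fun e => P e.1).card = (E.filter P).card := by
    intro P _
    have : (N.filter fun e => P e.1).image Subtype.val = E.filter P \ F.filter P := by
      ext e
      simp only [N, F, Finset.mem_image, Finset.mem_filter, Finset.mem_univ, true_and,
        Finset.mem_sdiff]
      constructor
      · rintro ⟨⟨e, he⟩, ⟨h1, h2⟩, rfl⟩
        exact ⟨⟨he, h2⟩, fun h => h1 (h.1.2 he)⟩
      · rintro ⟨⟨h1, h2⟩, h3⟩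
        exact ⟨⟨e, h1⟩, ⟨fun h => h3 ⟨⟨h1, fun _ => h⟩, h2⟩, h2⟩, rfl⟩
    rw [← Finset.card_image_of_injective _ Subtype.val_injective, this, add_comm]
    exact Finset.card_sdiff_add_card_eq_card
      (Finset.filter_subset_filter _ (Finset.filter_subset _ _))
  refine ⟨F, Finset.filter_subset _ _, fun x => ?_, fun y => ?_⟩
  · have a := hsplit fun e => e.1 = x
    have b := hN1 x
    have c := hd1 x
    omega
  · have a := hsplit fun e => e.2 = y
    have b := hN2 y
    have c := hd2 y
    omega

/-- A bipartite graph with many edges between any two large sets contains many disjoint perfect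
matchings. -/
theorem exists_disjoint_perms (E : Finset (Z × Z)) (r : ℕ)
    (hE : ∀ S T : Finset Z, r * (S.card + T.card) ≤
      (E.filter fun e => e.1 ∈ S ∧ e.2 ∈ T).card + r * Fintype.card Z) :
    ∃ f : Fin r → Equiv.Perm Z, (∀ i x, (x, f i x) ∈ E) ∧ ∀ i j x, f i x = f j x → i = j := by
  obtain ⟨F, hF, h1, h2⟩ := exists_regular_subgraph E r hE
  obtain ⟨f, hf1, hf2⟩ := exists_perms_of_regular r F h1 h2
  exact ⟨f, fun i x => hF (hf1 i x), hf2⟩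

end Factor

/-! ### Almost optimal packing of perfect matchings in random bipartite graphs -/

section RandomBipartite

variable {Z : Type*} [Fintype Z] [DecidableEq Z]
  {Ω : Type*} [MeasurableSpace Ω] {μ : Measure Ω} [IsProbabilityMeasure μ]
  {ξ : Z × Z → Ω → Prop} {p ε : ℝ}

-- Here |T| ≥ |Z|/2, so the excluded pairs make up at most a proportion ε/2 of S × T. Chernoff with
-- deviation ε/2 then suffices because (1 - ε/2)² ≥ 1 - ε, and at least |S||Z|/4 pairs remain for
-- the exponent.
open Classical in
lemma measureReal_few_edges (h : IsBernoulliFamily ξ p μ) (hp : 0 ≤ p) (hε0 : 0 ≤ ε)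
    (hε1 : ε ≤ 1) {Ex : Finset (Z × Z)} {d : ℕ} (hEx : ∀ x, (Ex.filter fun e => e.1 = x).card ≤ d)
    (hd : 4 * d ≤ ε * Fintype.card Z) {S T : Finset Z} (hST : S.card ≤ T.card)
    (hM : Fintype.card Z < S.card + T.card) :
    μ.real {ω | (((S ×ˢ T).filter fun e => e ∉ Ex ∧ ξ e ω).card : ℝ) ≤
      (1 - ε) * (p * (S.card * T.card))} ≤
      Real.exp (-(S.card * (ε ^ 2 * (p * Fintype.card Z) / 32))) := by
  set M := Fintype.card Z
  let W := (S ×ˢ T).filter fun e => e ∉ Ex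
  have hT : (M : ℝ) ≤ 2 * T.card := by exact_mod_cast (by omega : M ≤ 2 * T.card)
  have hs0 : (0 : ℝ) ≤ S.card := by positivity
  have hW : (1 - ε / 2) * (S.card * T.card) ≤ (W.card : ℝ) := by
    have h1 : (S ×ˢ T).card ≤ W.card + S.card * d := by
      have h2 : S ×ˢ T ⊆ W ∪ Ex.filter fun e => e.1 ∈ S := by
        intro e he
        by_cases hc : e ∈ Ex
        · exact Finset.mem_union_right _ (Finset.mem_filter.2 ⟨hc, (Finset.mem_product.1 he).1⟩)
        · exact Finset.mem_union_left _ (Finset.mem_filter.2 ⟨he, hc⟩)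
      refine (Finset.card_le_card h2).trans ((Finset.card_union_le _ _).trans ?_)
      have h3 : (Ex.filter fun e => e.1 ∈ S).card ≤ S.card * d := by
        have := card_filter_fst Ex S
        have h4 := Finset.sum_le_card_nsmul S _ d fun x _ => hEx x
        rw [smul_eq_mul] at h4
        convert this.le.trans h4
      have : (Finset.filter (fun e => e.1 ∈ S) Ex).card =
        (Ex.filter fun e => e.1 ∈ S).card := by congr
      omega
    rw [Finset.card_product] at h1
    have h1' : (S.card : ℝ) * T.card ≤ W.card + S.card * d := by exact_mod_cast h1
    have h5 : (d : ℝ) ≤ ε / 2 * T.card := by nlinarith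
    nlinarith [mul_le_mul_of_nonneg_left h5 hs0]
  have hsT : (0 : ℝ) ≤ S.card * T.card := by positivity
  refine le_trans (measureReal_mono ?_ (measure_ne_top _ _))
    ((h.measureReal_card_le W (by linarith : 0 ≤ ε / 2)).trans (Real.exp_le_exp.2 ?_))
  · intro ω hω
    simp only [Set.mem_ofPred_eq] at hω ⊢
    have e : W.filter (fun b => ξ b ω) = (S ×ˢ T).filter fun e => e ∉ Ex ∧ ξ e ω := by
      simp only [W, Finset.filter_filter]
    rw [e]
    refine hω.trans ?_
    have h6 : (1 - ε) * (S.card * T.card) ≤ (1 - ε / 2) * (W.card : ℝ) := by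
      have := mul_le_mul_of_nonneg_left hW (by linarith : (0 : ℝ) ≤ 1 - ε / 2)
      nlinarith [mul_nonneg (sq_nonneg (ε / 2)) hsT]
    nlinarith [mul_le_mul_of_nonneg_left h6 hp]
  · have h7 : (S.card : ℝ) * M ≤ 4 * W.card := by
      nlinarith [mul_le_mul_of_nonneg_left hT hs0]
    have h8 := mul_le_mul_of_nonneg_left h7 (mul_nonneg (sq_nonneg ε) hp)
    nlinarith

-- The union bound runs over S and the complement of T, which is smaller than S. For |S| = s there
-- are at most n^(2s) choices for each size of the complement, against a failure probability of
-- n^(-7s); the pairs of sizes cost another n².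
open Classical in
lemma measureReal_exists_few_edges (h : IsBernoulliFamily ξ p μ) (hp : 0 ≤ p) (hε0 : 0 ≤ ε)
    (hε1 : ε ≤ 1) {Ex : Finset (Z × Z)} {d : ℕ} (hEx : ∀ x, (Ex.filter fun e => e.1 = x).card ≤ d)
    (hd : 4 * d ≤ ε * Fintype.card Z) {n : ℕ} (hn : 1 ≤ n) (hZn : Fintype.card Z ≤ n)
    (hpn : 224 * Real.log n ≤ ε ^ 2 * (p * Fintype.card Z)) :
    μ.real {ω | ∃ S T : Finset Z, S.card ≤ T.card ∧ Fintype.card Z < S.card + T.card ∧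
      (((S ×ˢ T).filter fun e => e ∉ Ex ∧ ξ e ω).card : ℝ) ≤
      (1 - ε) * (p * (S.card * T.card))} ≤ ((n : ℝ) ^ 3)⁻¹ := by
  set M := Fintype.card Z with hMdef
  have hn1 : (1 : ℝ) ≤ n := by exact_mod_cast hn
  let B : Finset Z × Finset Z → Set Ω := fun P => {ω | P.1.card ≤ P.2ᶜ.card ∧
    M < P.1.card + P.2ᶜ.card ∧ (((P.1 ×ˢ P.2ᶜ).filter fun e => e ∉ Ex ∧ ξ e ω).card : ℝ) ≤
      (1 - ε) * (p * (P.1.card * P.2ᶜ.card))}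
  have hsub : {ω | ∃ S T : Finset Z, S.card ≤ T.card ∧ M < S.card + T.card ∧
      (((S ×ˢ T).filter fun e => e ∉ Ex ∧ ξ e ω).card : ℝ) ≤
      (1 - ε) * (p * (S.card * T.card))} ⊆
      ⋃ k ∈ (Finset.Icc 1 M).sigma (fun s => Finset.range s),
        ⋃ P ∈ Finset.powersetCard k.1 (Finset.univ : Finset Z) ×ˢ
          Finset.powersetCard k.2 (Finset.univ : Finset Z), B P := by
    rintro ω ⟨S, T, h1, h2, h3⟩
    have hc := Finset.card_compl_add_card T
    have hs := Finset.card_le_univ S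
    simp only [Set.mem_iUnion]
    refine ⟨⟨S.card, Tᶜ.card⟩, ?_, (S, Tᶜ), by simp, ?_⟩
    · simp only [Finset.mem_sigma, Finset.mem_Icc, Finset.mem_range]
      omega
    · simp only [B, Set.mem_ofPred_eq, compl_compl]
      exact ⟨h1, h2, h3⟩
  have hterm : ∀ k ∈ (Finset.Icc 1 M).sigma (fun s => Finset.range s),
      μ.real (⋃ P ∈ Finset.powersetCard k.1 (Finset.univ : Finset Z) ×ˢ
          Finset.powersetCard k.2 (Finset.univ : Finset Z), B P) ≤ ((n : ℝ) ^ 5)⁻¹ := by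
    rintro ⟨s, u⟩ hk
    simp only [Finset.mem_sigma, Finset.mem_Icc, Finset.mem_range] at hk
    have hB : ∀ P ∈ Finset.powersetCard s (Finset.univ : Finset Z) ×ˢ
          Finset.powersetCard u (Finset.univ : Finset Z), μ.real (B P) ≤
          ((n : ℝ) ^ (7 * s))⁻¹ := by
      rintro ⟨S, T⟩ hP
      simp only [Finset.mem_product, Finset.mem_powersetCard, Finset.subset_univ, true_and] at hP
      by_cases hc : S.card ≤ Tᶜ.card ∧ M < S.card + Tᶜ.card
      · refine le_trans (measureReal_mono (fun ω hω => hω.2.2) (measure_ne_top _ _))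
          ((measureReal_few_edges h hp hε0 hε1 hEx hd hc.1 hc.2).trans ?_)
        refine exp_neg_le_inv_pow (by omega) ?_
        rw [hP.1]
        push_cast
        have := mul_le_mul_of_nonneg_left hpn (Nat.cast_nonneg s : (0 : ℝ) ≤ s)
        linarith
      · have : B (S, T) = ∅ := by
          ext ω
          simp only [B, Set.mem_ofPred_eq, Set.mem_empty_iff_false, iff_false]
          rintro ⟨h1, h2, _⟩
          exact hc ⟨h1, h2⟩
        rw [this, measureReal_empty]
        positivity
    refine (measureReal_biUnion_finset_le _ _).trans ((Finset.sum_le_sum hB).trans ?_)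
    rw [Finset.sum_const, nsmul_eq_mul, Finset.card_product, Finset.card_powersetCard,
      Finset.card_powersetCard, Finset.card_univ, ← hMdef]
    have hc : M.choose s * M.choose u ≤ n ^ (2 * s) := by
      calc M.choose s * M.choose u ≤ M ^ s * M ^ u :=
            Nat.mul_le_mul (Nat.choose_le_pow _ _) (Nat.choose_le_pow _ _)
        _ = M ^ (s + u) := by rw [← pow_add]
        _ ≤ n ^ (s + u) := Nat.pow_le_pow_left hZn _
        _ ≤ n ^ (2 * s) := Nat.pow_le_pow_right (by omega) (by omega)
    have hc' : ((M.choose s * M.choose u : ℕ) : ℝ) ≤ (n : ℝ) ^ (2 * s) := by exact_mod_cast hc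
    refine (mul_le_mul_of_nonneg_right hc' (by positivity)).trans ?_
    rw [← div_eq_mul_inv, div_le_iff₀ (by positivity), inv_mul_eq_div, le_div_iff₀ (by positivity),
      ← pow_add]
    exact pow_le_pow_right₀ hn1 (by omega)
  refine (measureReal_mono hsub (measure_ne_top _ _)).trans
    ((measureReal_biUnion_finset_le _ _).trans ((Finset.sum_le_sum hterm).trans ?_))
  rw [Finset.sum_const, nsmul_eq_mul]
  have hcard : ((Finset.Icc 1 M).sigma (fun s => Finset.range s)).card ≤ n ^ 2 := by
    rw [Finset.card_sigma]
    simp only [Finset.card_range]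
    refine (Finset.sum_le_card_nsmul _ _ n fun s hs => ?_).trans ?_
    · rw [Finset.mem_Icc] at hs; omega
    · rw [Nat.card_Icc, smul_eq_mul, Nat.add_sub_cancel, sq]
      exact Nat.mul_le_mul_right _ hZn
  have hcard' : (((Finset.Icc 1 M).sigma (fun s => Finset.range s)).card : ℝ) ≤ (n : ℝ) ^ 2 := by
    exact_mod_cast hcard
  refine (mul_le_mul_of_nonneg_right hcard' (by positivity)).trans (le_of_eq ?_)
  have : (n : ℝ) ≠ 0 := by linarith
  field_simp

/-- A random bipartite graph contains almost the maximum number of disjoint perfect matchings. -/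
theorem measureReal_not_exists_perms (h : IsBernoulliFamily ξ p μ) (hp : 0 ≤ p) (hε0 : 0 ≤ ε)
    (hε1 : ε ≤ 1) {Ex : Finset (Z × Z)} {d : ℕ} (hEx : ∀ x, (Ex.filter fun e => e.1 = x).card ≤ d)
    (hEx' : ∀ y, (Ex.filter fun e => e.2 = y).card ≤ d)
    (hd : 4 * d ≤ ε * Fintype.card Z) {n : ℕ} (hn : 1 ≤ n) (hZn : Fintype.card Z ≤ n)
    (hpn : 224 * Real.log n ≤ ε ^ 2 * (p * Fintype.card Z)) {r : ℕ}
    (hr : r ≤ (1 - ε) * (p * Fintype.card Z)) :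
    μ.real {ω | ¬ ∃ f : Fin r → Equiv.Perm Z, (∀ i x, (x, f i x) ∉ Ex ∧ ξ (x, f i x) ω) ∧
      ∀ i j x, f i x = f j x → i = j} ≤ 2 * ((n : ℝ) ^ 3)⁻¹ := by
  classical
  have b1 := measureReal_exists_few_edges h hp hε0 hε1 hEx hd hn hZn hpn
  -- The edge bound assumes |S| ≤ |T|; exchanging the two sides covers the opposite case.
  have hsw := h.precomp (g := Prod.swap) Prod.swap_injective
  have b2 := measureReal_exists_few_edges (Ex := Ex.image Prod.swap) hsw hp hε0 hε1 (d := d) ?_ hd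
    hn hZn hpn
  swap
  · intro x
    refine le_trans ?_ (hEx' x)
    rw [← Finset.card_image_of_injective (Ex.filter fun e => e.2 = x) Prod.swap_injective]
    refine Finset.card_le_card fun e he => ?_
    simp only [Finset.mem_filter, Finset.mem_image] at he ⊢
    obtain ⟨⟨a, ha, rfl⟩, he⟩ := he
    exact ⟨a, ⟨ha, by simpa using he⟩, rfl⟩
  refine le_trans (measureReal_mono ?_ (measure_ne_top _ _))
    ((measureReal_union_le _ _).trans ((add_le_add b1 b2).trans (by linarith)))
  intro ω hω
  by_contra hc
  simp only [Set.mem_union, Set.mem_ofPred_eq, not_or, not_exists, not_and, not_le] at hc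
  obtain ⟨c1, c2⟩ := hc
  refine hω ?_
  let E : Finset (Z × Z) := Finset.univ.filter fun e => e ∉ Ex ∧ ξ e ω
  have key : ∀ S T : Finset Z, Fintype.card Z < S.card + T.card →
      (1 - ε) * (p * (S.card * T.card)) < ((E.filter fun e => e.1 ∈ S ∧ e.2 ∈ T).card : ℝ) := by
    intro S T hST
    rcases le_total S.card T.card with hle | hle
    · refine (c1 S T hle hST).trans_le ?_
      norm_cast
      refine Finset.card_le_card fun e he => ?_
      simp only [E, Finset.mem_filter, Finset.mem_product, Finset.mem_univ, true_and] at he ⊢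
      exact ⟨he.2, he.1⟩
    · have := c2 T S hle (by omega)
      rw [mul_comm (T.card : ℝ)] at this
      refine this.trans_le ?_
      norm_cast
      rw [← Finset.card_image_of_injective _ Prod.swap_injective]
      refine Finset.card_le_card fun e he => ?_
      simp only [Finset.mem_image, Finset.mem_filter, Finset.mem_product] at he
      obtain ⟨a, ⟨ha1, ha2, ha3⟩, rfl⟩ := he
      simp only [E, Finset.mem_filter, Finset.mem_univ, true_and]
      exact ⟨⟨fun hx => ha2 ⟨a.swap, hx, by simp⟩, ha3⟩, ha1.2, ha1.1⟩
  have hE : ∀ S T : Finset Z, r * (S.card + T.card) ≤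
      (E.filter fun e => e.1 ∈ S ∧ e.2 ∈ T).card + r * Fintype.card Z := by
    intro S T
    by_cases hST : Fintype.card Z < S.card + T.card
    · have k1 := key S T hST
      set M := Fintype.card Z
      have hs : (S.card : ℝ) ≤ M := by exact_mod_cast Finset.card_le_univ S
      have ht : (T.card : ℝ) ≤ M := by exact_mod_cast Finset.card_le_univ T
      have hST' : (M : ℝ) < S.card + T.card := by exact_mod_cast hST
      -- Rests on M(|S| + |T| - M) ≤ |S||T|, that is, (M - |S|)(M - |T|) ≥ 0.
      have k2 : (r : ℝ) * (S.card + T.card - M) ≤ (1 - ε) * (p * (S.card * T.card)) := by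
        calc (r : ℝ) * (S.card + T.card - M) ≤
              (1 - ε) * (p * M) * (S.card + T.card - M) :=
              mul_le_mul_of_nonneg_right hr (by linarith)
          _ = (1 - ε) * p * (M * (S.card + T.card - M)) := by ring
          _ ≤ (1 - ε) * p * (S.card * T.card) := by
              refine mul_le_mul_of_nonneg_left ?_ (mul_nonneg (by linarith) hp)
              nlinarith
          _ = _ := by ring
      have k3 : ((r * (S.card + T.card) : ℕ) : ℝ) ≤
          (((E.filter fun e => e.1 ∈ S ∧ e.2 ∈ T).card + r * M : ℕ) : ℝ) := by
        push_cast
        nlinarith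
      exact_mod_cast k3
    · have := Nat.mul_le_mul_left r (not_lt.1 hST)
      omega
  obtain ⟨f, hf1, hf2⟩ := exists_disjoint_perms E r hE
  exact ⟨f, fun i x => by simpa [E] using hf1 i x, hf2⟩

end RandomBipartite

/-! ### Transitive maps and Hamilton cycles -/

section Transitive

/-- The iterates of `s` lead from every point to every other point. -/
def IsTransitive {V : Type*} (s : V → V) : Prop := ∀ u v, ∃ t : ℕ, s^[t] u = v

lemma IsTransitive.isHamiltonCycle {V : Type*} [Finite V] [Nonempty V] {s : V → V}
    (hs : IsTransitive s) {D : Digraph V} (hD : ∀ v, D.Adj v (s v)) :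
    D.IsHamiltonCycle (Set.range fun v => (v, s v)) := by
  classical
  have := Fintype.ofFinite V
  have hsurj : Function.Surjective s := by
    intro v
    obtain ⟨t, ht⟩ := hs (s v) v
    refine ⟨s^[t] v, ?_⟩
    rw [← Function.iterate_succ_apply' s t v, Function.iterate_succ_apply, ht]
  let π : Equiv.Perm V := Equiv.ofBijective s (Finite.surjective_iff_bijective.1 hsurj)
  have hπ : ∀ (t : ℕ) v, (π ^ t) v = s^[t] v := by
    intro t v
    rw [Equiv.Perm.coe_pow]
    rfl
  have hcyc : π.IsCycleOn ((Finset.univ : Finset V) : Set V) := by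
    refine ⟨by simp, fun u _ v _ => ?_⟩
    obtain ⟨t, ht⟩ := hs u v
    exact ⟨t, by rw [zpow_natCast, hπ, ht]⟩
  obtain ⟨v₀⟩ : Nonempty V := inferInstance
  have hcard : Nat.card V = (Finset.univ : Finset V).card := by
    rw [Nat.card_eq_fintype_card, Finset.card_univ]
  have hne : NeZero (Nat.card V) := ⟨Nat.card_ne_zero.2 ⟨⟨v₀⟩, inferInstance⟩⟩
  let w : ZMod (Nat.card V) → V := fun i => (π ^ i.val) v₀
  have hw : Function.Surjective w := by
    intro v
    obtain ⟨t, ht, h⟩ := hcyc.exists_pow_eq (Finset.mem_univ v₀) (Finset.mem_univ v)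
    refine ⟨(t : ZMod (Nat.card V)), ?_⟩
    simp only [w]
    rw [ZMod.val_natCast_of_lt (by omega), h]
  have hwb : Function.Bijective w := by
    refine (Fintype.bijective_iff_surjective_and_card w).2 ⟨hw, ?_⟩
    rw [ZMod.card, Nat.card_eq_fintype_card]
  have hstep : ∀ i, w (i + 1) = s (w i) := by
    intro i
    have e : s (w i) = (π ^ (i.val + 1)) v₀ := by rw [pow_succ']; rfl
    rw [e]
    simp only [w]
    rw [hcyc.pow_apply_eq_pow_apply (Finset.mem_univ v₀), ← hcard,
      ← ZMod.natCast_eq_natCast_iff]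
    simp
  refine ⟨Equiv.ofBijective w hwb, ?_, ?_⟩
  · ext ⟨u, v⟩
    simp only [Set.mem_range, Equiv.ofBijective_apply, hstep, Prod.mk.injEq]
    constructor
    · rintro ⟨x, rfl, rfl⟩
      obtain ⟨i, rfl⟩ := hw x
      exact ⟨i, rfl, rfl⟩
    · rintro ⟨i, rfl, rfl⟩
      exact ⟨_, rfl, rfl⟩
  · rintro _ ⟨v, rfl⟩
    exact hD v

lemma IsTransitive.conj {V W : Type*} {s : V → V} (hs : IsTransitive s) (e : V ≃ W) :
    IsTransitive (fun w => e (s (e.symm w))) := by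
  intro u v
  obtain ⟨t, ht⟩ := hs (e.symm u) (e.symm v)
  refine ⟨t, ?_⟩
  have : Function.Semiconj e s (fun w => e (s (e.symm w))) := fun x => by simp
  have h := (this.iterate_right t).eq (e.symm u)
  rw [ht] at h
  simpa using h.symm

lemma IsTransitive.apply_ne {V : Type*} [Nontrivial V] {s : V → V} (hs : IsTransitive s) (v : V) :
    s v ≠ v := by
  intro hv
  obtain ⟨u, hu⟩ := exists_ne v
  obtain ⟨t, ht⟩ := hs v u
  rw [Function.iterate_fixed hv] at ht
  exact hu ht.symm

end Transitive

/-! ### Walking through the clusters with a fixed step -/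

section Clusters

variable {L m r : ℕ}

/-- `L` clusters of size `m`, indexed by the residues modulo `L`, and `r` leftover vertices. -/
abbrev Clustered (L m r : ℕ) : Type := (ZMod L × Fin m) ⊕ Fin r

/-- The cluster `c` together with the leftover vertices. -/
def clusterEmb (c : ZMod L) : Fin m ⊕ Fin r → Clustered L m r
  | .inl x => .inl (c, x)
  | .inr j => .inr j

lemma clusterEmb_injective (c : ZMod L) :
    Function.Injective (clusterEmb c : Fin m ⊕ Fin r → Clustered L m r) := by
  rintro (x | j) (y | j') h <;> simp [clusterEmb] at h ⊢ <;> exact h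

/-- Follow `h`, skipping over the leftover vertices. -/
def bypass (h : Equiv.Perm (Fin m ⊕ Fin r)) (x : Fin m) : Fin m :=
  match h (.inl x) with
  | .inl y => y
  | .inr j =>
    match h (.inr j) with
    | .inl y => y
    -- A default value, never reached when no leftover is followed by a leftover.
    | .inr _ => x

lemma bypass_injective {h : Equiv.Perm (Fin m ⊕ Fin r)} (hh : ∀ j, (h (.inr j)).isLeft) :
    Function.Injective (bypass h) := by
  have hh' : ∀ j, ∃ y, h (.inr j) = .inl y := fun j => Sum.isLeft_iff.1 (hh j)
  intro x x' hx
  unfold bypass at hx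
  rcases h1 : h (.inl x) with y | j <;> rcases h2 : h (.inl x') with y' | j' <;>
    simp only [h1, h2] at hx
  · subst hx
    simpa using h.injective (h1.trans h2.symm)
  · obtain ⟨z, hz⟩ := hh' j'
    simp only [hz] at hx
    subst hx
    simpa using h.injective (h1.trans hz.symm)
  · obtain ⟨z, hz⟩ := hh' j
    simp only [hz] at hx
    subst hx
    simpa using h.injective (h2.trans hz.symm)
  · obtain ⟨z, hz⟩ := hh' j
    obtain ⟨z', hz'⟩ := hh' j'
    simp only [hz, hz'] at hx
    subst hx
    have : j = j' := by simpa using h.injective (hz.trans hz'.symm)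
    subst this
    simpa using h.injective (h1.trans h2.symm)

open Classical in
/-- `bypass h` as a permutation. -/
noncomputable def bypassPerm (h : Equiv.Perm (Fin m ⊕ Fin r)) : Equiv.Perm (Fin m) :=
  if hh : Function.Injective (bypass h) then
    Equiv.ofBijective _ (Finite.injective_iff_bijective.1 hh) else 1

lemma bypassPerm_apply {h : Equiv.Perm (Fin m ⊕ Fin r)} (hh : ∀ j, (h (.inr j)).isLeft)
    (x : Fin m) : bypassPerm h x = bypass h x := by
  simp [bypassPerm, bypass_injective hh]

/-- The composition `g (k + j - 1) * ⋯ * g (k + 1) * g k`. -/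
def slotComp (g : ZMod L → Equiv.Perm (Fin m)) (k : ZMod L) : ℕ → Equiv.Perm (Fin m)
  | 0 => 1
  | j + 1 => g (k + j) * slotComp g k j

lemma slotComp_congr {g g' : ZMod L → Equiv.Perm (Fin m)} {k : ZMod L} {j : ℕ}
    (h : ∀ i < j, g (k + i) = g' (k + i)) : slotComp g k j = slotComp g' k j := by
  induction j with
  | zero => rfl
  | succ j ih =>
    rw [slotComp, slotComp, ih fun i hi => h i (by omega), h j (by omega)]

/-- The `L - 1` slots that follow the closing slot `κ` do not include `κ`, so the path system never
uses it. -/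
lemma add_one_add_natCast_ne (κ : ZMod L) {i : ℕ} (hi : i < L - 1) : κ + 1 + i ≠ κ := by
  intro h
  have h1 : ((i + 1 : ℕ) : ZMod L) = 0 := by
    push_cast
    linear_combination h
  rw [ZMod.natCast_eq_zero_iff] at h1
  exact absurd (Nat.le_of_dvd (by omega) h1) (by omega)

/-- The successor map that walks through the clusters with step `a`, using `f k` between the
clusters `a * k` and `a * k + a` for `k ≠ 1` and `h` for `k = 1`. -/
def walkSucc (a : ZMod L) (f : ZMod L → Equiv.Perm (Fin m)) (h : Equiv.Perm (Fin m ⊕ Fin r)) :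
    Clustered L m r → Clustered L m r
  | .inl (c, x) => if c = a then clusterEmb (a + a) (h (.inl x)) else .inl (c + a, f (c * a⁻¹) x)
  | .inr j => clusterEmb (a + a) (h (.inr j))

variable [Fact L.Prime]

lemma walkSucc_reach {a : ZMod L} (ha : a ≠ 0) {f : ZMod L → Equiv.Perm (Fin m)}
    {h : Equiv.Perm (Fin m ⊕ Fin r)} (hh : ∀ j, (h (.inr j)).isLeft)
    (k : ZMod L) (x : Fin m) : ∃ t : ℕ, (walkSucc a f h)^[t] (.inl (a * k, x)) =
      .inl (a * (k + 1), (if k = 1 then bypassPerm h else f k) x) := by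
  by_cases hk : k = 1
  · subst hk
    have e : a * (1 + 1) = a + a := by ring
    rw [if_pos rfl, bypassPerm_apply hh, mul_one, e]
    rcases h1 : h (.inl x) with y | j
    · exact ⟨1, by simp [walkSucc, bypass, h1, clusterEmb]⟩
    · obtain ⟨z, hz⟩ := Sum.isLeft_iff.1 (hh j)
      exact ⟨2, by simp [walkSucc, bypass, h1, clusterEmb, hz]⟩
  · refine ⟨1, ?_⟩
    have hne : a * k ≠ a := by
      intro hc
      exact hk (mul_left_cancel₀ ha (by rw [hc, mul_one]))
    have e : a * k * a⁻¹ = k := by field_simp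
    simp [walkSucc, hne, hk, e, mul_add]

/-- One full round that starts in the cluster `a * (κ + 1)` acts on this cluster by the permutation
in `hσ`, whose powers are transitive. Since `a ≠ 0` modulo a prime, the round meets every cluster,
and each leftover has a cluster vertex before and after it. -/
theorem walkSucc_isTransitive {a : ZMod L} (ha : a ≠ 0) {f : ZMod L → Equiv.Perm (Fin m)}
    {h : Equiv.Perm (Fin m ⊕ Fin r)} (hh : ∀ j, (h (.inr j)).isLeft) {κ : ZMod L} (hκ : κ ≠ 1)
    (hσ : ∀ x y, ∃ t : ℕ, ((f κ * slotComp (fun k => if k = 1 then bypassPerm h else f k)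
      (κ + 1) (L - 1)) ^ t) x = y) : IsTransitive (walkSucc a f h) := by
  let g : ZMod L → Equiv.Perm (Fin m) := fun k => if k = 1 then bypassPerm h else f k
  let s := walkSucc a f h
  let R : Clustered L m r → Clustered L m r → Prop := fun u v => ∃ t : ℕ, s^[t] u = v
  have hL : 2 ≤ L := (Fact.out : L.Prime).two_le
  have Rtrans : ∀ u v w, R u v → R v w → R u w := by
    rintro u v w ⟨t, rfl⟩ ⟨t', rfl⟩
    exact ⟨t' + t, by rw [Function.iterate_add_apply]⟩
  have R1 : ∀ k x, R (.inl (a * k, x)) (.inl (a * (k + 1), g k x)) := walkSucc_reach ha hh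
  let P := slotComp g (κ + 1)
  have R2 : ∀ (j i : ℕ) y, R (.inl (a * (κ + 1 + j), P j y))
      (.inl (a * (κ + 1 + (j + i : ℕ)), P (j + i) y)) := by
    intro j i y
    induction i with
    | zero => exact ⟨0, by simp⟩
    | succ i ih =>
      refine Rtrans _ _ _ ih ?_
      have := R1 (κ + 1 + (j + i : ℕ)) (P (j + i) y)
      have e : κ + 1 + ((j + (i + 1) : ℕ) : ZMod L) = κ + 1 + (j + i : ℕ) + 1 := by push_cast; ring
      rw [e]
      exact this
  have hPL : P L = f κ * slotComp g (κ + 1) (L - 1) := by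
    obtain ⟨l, hl⟩ : ∃ l, L = l + 1 := ⟨L - 1, by omega⟩
    have hl' : κ + 1 + (l : ZMod L) = κ := by
      have : ((l + 1 : ℕ) : ZMod L) = 0 := by rw [← hl]; exact ZMod.natCast_self L
      push_cast at this
      linear_combination this
    have e1 : P L = P (l + 1) := by rw [← hl]
    have e2 : L - 1 = l := by omega
    rw [e1, e2]
    change g (κ + 1 + l) * slotComp g (κ + 1) l = _
    rw [hl']
    simp [g, hκ]
  have R3 : ∀ y, R (.inl (a * (κ + 1), y)) (.inl (a * (κ + 1), P L y)) := by
    intro y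
    have := R2 0 L y
    simpa [P, slotComp] using this
  have R4 : ∀ y y', R (.inl (a * (κ + 1), y)) (.inl (a * (κ + 1), y')) := by
    intro y y'
    obtain ⟨t, ht⟩ := hσ y y'
    rw [← hPL] at ht
    subst ht
    induction t with
    | zero => exact ⟨0, rfl⟩
    | succ t ih =>
      rw [pow_succ', Equiv.Perm.mul_apply]
      exact Rtrans _ _ _ ih (R3 _)
  have R5 : ∀ c x, ∃ j < L, ∃ y, (c, x) = (a * (κ + 1 + j), P j y) := by
    intro c x
    let j := (c * a⁻¹ - κ - 1).val
    refine ⟨j, ZMod.val_lt _, (P j).symm x, ?_⟩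
    have : ((j : ℕ) : ZMod L) = c * a⁻¹ - κ - 1 := ZMod.natCast_zmod_val _
    rw [this, Equiv.apply_symm_apply]
    congr 1
    field_simp
    ring
  have R6 : ∀ u, ∃ y, R u (.inl (a * (κ + 1), y)) := by
    have inl : ∀ c x, ∃ y, R (.inl (c, x)) (.inl (a * (κ + 1), y)) := by
      intro c x
      obtain ⟨j, hj, y, hy⟩ := R5 c x
      rw [hy]
      have := R2 j (L - j) y
      rw [Nat.add_sub_cancel' hj.le, ZMod.natCast_self, add_zero] at this
      exact ⟨_, this⟩
    rintro (⟨c, x⟩ | j)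
    · exact inl c x
    · obtain ⟨z, hz⟩ := Sum.isLeft_iff.1 (hh j)
      obtain ⟨y, hy⟩ := inl (a + a) z
      exact ⟨y, Rtrans _ _ _ ⟨1, by simp [s, walkSucc, hz, clusterEmb]⟩ hy⟩
  have R7 : ∀ u, ∃ y, R (.inl (a * (κ + 1), y)) u := by
    have inl : ∀ c x, ∃ y, R (.inl (a * (κ + 1), y)) (.inl (c, x)) := by
      intro c x
      obtain ⟨j, hj, y, hy⟩ := R5 c x
      rw [hy]
      have := R2 0 j y
      refine ⟨y, ?_⟩
      simpa [P, slotComp] using this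
    rintro (⟨c, x⟩ | j)
    · exact inl c x
    · rcases hz : h.symm (.inr j) with x | j'
      · obtain ⟨y, hy⟩ := inl a x
        refine ⟨y, Rtrans _ _ _ hy ⟨1, ?_⟩⟩
        have : h (.inl x) = .inr j := by rw [← hz]; simp
        simp [s, walkSucc, this, clusterEmb]
      · have : h (.inr j') = .inr j := by rw [← hz]; simp
        have h2 := hh j'
        rw [this] at h2
        simp at h2
  intro u v
  obtain ⟨y, hy⟩ := R6 u
  obtain ⟨y', hy'⟩ := R7 v
  exact Rtrans _ _ _ hy (Rtrans _ _ _ (R4 y y') hy')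

end Clusters

/-! ### From a good labelling to arc-disjoint Hamilton cycles -/

section Assembly

/-- The label of an arc: `none` if it is absent, `some none` if it serves in the perfect matchings
between clusters, `some (some c)` if it may close cycles in round `c`. -/
abbrev Label (N : ℕ) : Type := Option (Option (Fin N))

/-- Names of the cycles that walk with a fixed step: the slot at which the cycle is closed and the
round. -/
abbrev CycleIndex (L N : ℕ) : Type := {k : ZMod L // k ≠ 1} × Fin N

/-- `F` consists of pairwise disjoint perfect matchings of the bipartite graph `A`. -/
def IsMatchingFamily {Z I : Type*} (A : Z × Z → Prop) (F : I → Equiv.Perm Z) : Prop :=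
  (∀ i x, A (x, F i x)) ∧ ∀ i j x, F i x = F j x → i = j

open Classical in
/-- A choice of disjoint perfect matchings of `A`, if there are any. -/
noncomputable def matchings {Z : Type*} (I : Type*) (A : Z × Z → Prop) : I → Equiv.Perm Z :=
  if h : ∃ F : I → Equiv.Perm Z, IsMatchingFamily A F then h.choose else fun _ => 1

lemma isMatchingFamily_matchings {Z I : Type*} {A : Z × Z → Prop}
    (h : ∃ F : I → Equiv.Perm Z, IsMatchingFamily A F) : IsMatchingFamily A (matchings I A) := by
  rw [matchings, dif_pos h]
  exact h.choose_spec

variable {L m r N : ℕ}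

/-- The arcs from the cluster `a * k` to the cluster `a * k + a`. -/
def slotArc (a k : ZMod L) (z : Fin m × Fin m) : Clustered L m r × Clustered L m r :=
  (.inl (a * k, z.1), .inl (a * k + a, z.2))

/-- The arcs from the cluster `a` to the cluster `a + a`, with the leftover vertices added on both
sides. -/
def extArc (a : ZMod L) (z : (Fin m ⊕ Fin r) × (Fin m ⊕ Fin r)) :
    Clustered L m r × Clustered L m r :=
  (clusterEmb a z.1, clusterEmb (a + a) z.2)

/-- The bipartite graph of the matching arcs between two consecutive clusters. -/
def slotGraph (lab : Clustered L m r × Clustered L m r → Label N) (a k : ZMod L)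
    (z : Fin m × Fin m) : Prop :=
  lab (slotArc a k z) = some none

/-- The bipartite graph of the matching arcs in the slot with the leftover vertices. -/
def extGraph (lab : Clustered L m r × Clustered L m r → Label N) (a : ZMod L)
    (z : (Fin m ⊕ Fin r) × (Fin m ⊕ Fin r)) : Prop :=
  ¬ (z.1.isRight ∧ z.2.isRight) ∧ lab (extArc a z) = some none

/-- The bijections along the `i`-th walk with step `a`. -/
noncomputable def slotPerm (lab : Clustered L m r × Clustered L m r → Label N) (a : ZMod L)
    (i : CycleIndex L N) (k : ZMod L) : Equiv.Perm (Fin m) :=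
  if k = 1 then bypassPerm (matchings (CycleIndex L N) (extGraph lab a) i)
  else matchings (CycleIndex L N) (slotGraph lab a k) i

/-- The paths of the `i`-th walk with step `a`, as a bijection from their starts to their ends. -/
noncomputable def pathPerm (lab : Clustered L m r × Clustered L m r → Label N) (a : ZMod L)
    (i : CycleIndex L N) : Equiv.Perm (Fin m) :=
  slotComp (slotPerm lab a i) (i.1.1 + 1) (L - 1)

/-- `τ` closes the paths with bijection `σ` to a single cycle. -/
def Closes (lab : Clustered L m r × Clustered L m r → Label N) (a : ZMod L) (i : CycleIndex L N)
    (σ τ : Equiv.Perm (Fin m)) : Prop :=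
  (∀ x, lab (slotArc a i.1.1 (x, τ x)) = some (some i.2)) ∧
    ∀ x y, ∃ t : ℕ, ((τ * σ) ^ t) x = y

/-- All the matchings exist and all the walks can be closed. -/
structure IsGoodLabelling (lab : Clustered L m r × Clustered L m r → Label N) : Prop where
  ext : ∀ a ≠ 0, ∃ F : CycleIndex L N → Equiv.Perm (Fin m ⊕ Fin r),
    IsMatchingFamily (extGraph lab a) F
  slot : ∀ a ≠ 0, ∀ k ≠ 1, ∃ F : CycleIndex L N → Equiv.Perm (Fin m),
    IsMatchingFamily (slotGraph lab a k) F
  closes : ∀ a ≠ 0, ∀ i, ∃ τ, Closes lab a i (pathPerm lab a i) τ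

variable [Fact L.Prime]

lemma exists_walk {lab : Clustered L m r × Clustered L m r → Label N} (hlab : IsGoodLabelling lab)
    {a : ZMod L} (ha : a ≠ 0) (i : CycleIndex L N) :
    ∃ (f : ZMod L → Equiv.Perm (Fin m)),
      IsTransitive (walkSucc (r := r) a f (matchings (CycleIndex L N) (extGraph lab a) i)) ∧
      (∀ k ≠ 1, k ≠ i.1.1 → f k = matchings (CycleIndex L N) (slotGraph lab a k) i) ∧
      ∀ x, lab (slotArc a i.1.1 (x, f i.1.1 x)) = some (some i.2) := by
  obtain ⟨τ, hτ1, hτ2⟩ := hlab.closes a ha i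
  let f : ZMod L → Equiv.Perm (Fin m) := fun k =>
    if k = i.1.1 then τ else matchings (CycleIndex L N) (slotGraph lab a k) i
  have hext := isMatchingFamily_matchings (hlab.ext a ha)
  refine ⟨f, walkSucc_isTransitive ha ?_ i.1.2 ?_, ?_, ?_⟩
  · intro j
    have := (hext.1 i (.inr j)).1
    simp only [Sum.isRight_inr, true_and, Bool.not_eq_true, Sum.isRight_eq_false] at this
    exact this
  · have e : slotComp (fun k => if k = 1 then
        bypassPerm (matchings (CycleIndex L N) (extGraph lab a) i) else f k) (i.1.1 + 1) (L - 1) =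
        pathPerm lab a i := by
      refine slotComp_congr fun j hj => ?_
      have hne := add_one_add_natCast_ne i.1.1 hj
      simp only [slotPerm, f, hne, if_false]
    rw [e]
    simpa [f] using hτ2
  · intro k _ hk
    simp [f, hk]
  · simpa [f] using hτ1

lemma walkSucc_fst {a : ZMod L} {f : ZMod L → Equiv.Perm (Fin m)}
    {h : Equiv.Perm (Fin m ⊕ Fin r)} {c : ZMod L} {x : Fin m} {u : Clustered L m r}
    (hu : walkSucc a f h (.inl (c, x)) = u) :
    (∃ y, u = .inl (c + a, y)) ∨ (∃ j, u = .inr j) ∧ c = a := by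
  subst hu
  by_cases hc : c = a
  · subst hc
    rcases hz : h (.inl x) with y | j <;> simp [walkSucc, hz, clusterEmb]
  · simp [walkSucc, hc]

/-- Distinct walks are arc-disjoint. -/
lemma walk_arc_unique (hL : 2 < L) {lab : Clustered L m r × Clustered L m r → Label N}
    (hlab : IsGoodLabelling lab) {a a' : ZMod L} (ha : a ≠ 0) (ha' : a' ≠ 0)
    {i i' : CycleIndex L N} {f f' : ZMod L → Equiv.Perm (Fin m)}
    (hf : ∀ k ≠ 1, k ≠ i.1.1 → f k = matchings (CycleIndex L N) (slotGraph lab a k) i)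
    (hf' : ∀ k ≠ 1, k ≠ i'.1.1 → f' k = matchings (CycleIndex L N) (slotGraph lab a' k) i')
    (hc : ∀ x, lab (slotArc a i.1.1 (x, f i.1.1 x)) = some (some i.2))
    (hc' : ∀ x, lab (slotArc a' i'.1.1 (x, f' i'.1.1 x)) = some (some i'.2))
    {u : Clustered L m r}
    (hu : walkSucc a f (matchings (CycleIndex L N) (extGraph lab a) i) u =
      walkSucc a' f' (matchings (CycleIndex L N) (extGraph lab a') i') u) : a = a' ∧ i = i' := by
  have hext := isMatchingFamily_matchings (hlab.ext a ha)
  have hext' := isMatchingFamily_matchings (hlab.ext a' ha')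
  have hleft : ∀ j, ∃ y, matchings (CycleIndex L N) (extGraph lab a) i (.inr j) = .inl y := by
    intro j
    have := (hext.1 i (.inr j)).1
    simp only [Sum.isRight_inr, true_and, Bool.not_eq_true, Sum.isRight_eq_false] at this
    exact Sum.isLeft_iff.1 this
  have hleft' : ∀ j, ∃ y, matchings (CycleIndex L N) (extGraph lab a') i' (.inr j) = .inl y := by
    intro j
    have := (hext'.1 i' (.inr j)).1
    simp only [Sum.isRight_inr, true_and, Bool.not_eq_true, Sum.isRight_eq_false] at this
    exact Sum.isLeft_iff.1 this
  have haa : a = a' := by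
    rcases u with ⟨c, x⟩ | j
    · rcases walkSucc_fst hu with ⟨y, hy⟩ | ⟨⟨j, hj⟩, rfl⟩
      · rcases walkSucc_fst hu.symm with ⟨y', hy'⟩ | ⟨⟨j, hj⟩, -⟩
        · rw [hu, hy] at hy'
          exact (by simpa using hy' : a = a' ∧ y = y').1
        · rw [hu, hy] at hj; simp at hj
      · rcases walkSucc_fst hu.symm with ⟨y', hy'⟩ | ⟨-, h⟩
        · rw [hu, hj] at hy'; simp at hy'
        · exact h
    · obtain ⟨y, hy⟩ := hleft j
      obtain ⟨y', hy'⟩ := hleft' j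
      simp only [walkSucc, hy, hy', clusterEmb, Sum.inl.injEq, Prod.mk.injEq] at hu
      -- An arc leaving a leftover only reveals the cluster `2a` that it enters; `L` is odd, so this
      -- determines `a`.
      have h2 : (2 : ZMod L) ≠ 0 := by
        have : ((2 : ℕ) : ZMod L) ≠ 0 := by
          rw [Ne, ZMod.natCast_eq_zero_iff]
          exact fun h => absurd (Nat.le_of_dvd (by norm_num) h) (by omega)
        exact_mod_cast this
      exact mul_left_cancel₀ h2 (by linear_combination hu.1)
  subst haa
  refine ⟨rfl, ?_⟩
  rcases u with ⟨c, x⟩ | j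
  · by_cases hca : c = a
    · subst hca
      simp only [walkSucc, if_true] at hu
      exact hext.2 _ _ _ (clusterEmb_injective _ hu)
    · simp only [walkSucc, hca, if_false, Sum.inl.injEq, Prod.mk.injEq, true_and] at hu
      set k := c * a⁻¹ with hk
      have hk1 : k ≠ 1 := by
        intro h1
        apply hca
        rw [hk] at h1
        field_simp at h1
        exact h1
      have hslot := isMatchingFamily_matchings (hlab.slot a ha k hk1)
      -- If both walks close in slot `k`, the label names the round. If only one does, a closing
      -- label would equal a matching label. If neither does, disjointness of the matchings decides.
      by_cases h1 : k = i.1.1 <;> by_cases h2 : k = i'.1.1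
      · have e1 := hc x
        have e2 := hc' x
        rw [← h1] at e1
        rw [← h2, ← hu, e1] at e2
        simp only [Option.some.injEq] at e2
        exact Prod.ext (Subtype.ext (h1.symm.trans h2)) e2
      · have e1 := hc x
        rw [← h1, hu, hf' k hk1 h2] at e1
        have e2 : lab (slotArc a k (x, _)) = some none := hslot.1 i' x
        rw [e1] at e2
        simp at e2
      · have e1 := hc' x
        rw [← h2, ← hu, hf k hk1 h1] at e1
        have e2 : lab (slotArc a k (x, _)) = some none := hslot.1 i x
        rw [e1] at e2
        simp at e2
      · rw [hf k hk1 h1, hf' k hk1 h2] at hu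
        exact hslot.2 _ _ _ hu
  · simp only [walkSucc] at hu
    exact hext.2 _ _ _ (clusterEmb_injective _ hu)

lemma walk_label {lab : Clustered L m r × Clustered L m r → Label N}
    (hlab : IsGoodLabelling lab) {a : ZMod L} (ha : a ≠ 0)
    {i : CycleIndex L N} {f : ZMod L → Equiv.Perm (Fin m)}
    (hf : ∀ k ≠ 1, k ≠ i.1.1 → f k = matchings (CycleIndex L N) (slotGraph lab a k) i)
    (hc : ∀ x, lab (slotArc a i.1.1 (x, f i.1.1 x)) = some (some i.2)) (u : Clustered L m r) :
    lab (u, walkSucc a f (matchings (CycleIndex L N) (extGraph lab a) i) u) ≠ none := by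
  have hext := isMatchingFamily_matchings (hlab.ext a ha)
  rcases u with ⟨c, x⟩ | j
  · by_cases hca : c = a
    · subst hca
      have := (hext.1 i (.inl x)).2
      simp only [extArc] at this
      simp only [walkSucc, if_true]
      exact ne_of_eq_of_ne this (by simp)
    · simp only [walkSucc, hca, if_false]
      set k := c * a⁻¹ with hk
      have hak : a * k = c := by rw [hk]; field_simp
      have hk1 : k ≠ 1 := by
        rintro h1
        rw [h1, mul_one] at hak
        exact hca hak.symm
      by_cases h1 : k = i.1.1
      · have e := hc x
        rw [← h1] at e
        simp only [slotArc, hak] at e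
        rw [e]; simp
      · have e : lab (slotArc a k (x, _)) = some none :=
          (isMatchingFamily_matchings (hlab.slot a ha k hk1)).1 i x
        simp only [slotArc, hak] at e
        rw [hf k hk1 h1, e]; simp
  · have := (hext.1 i (.inr j)).2
    simp only [extArc] at this
    simp only [walkSucc]
    exact ne_of_eq_of_ne this (by simp)

/-- A good labelling yields a packing of Hamilton cycles. -/
theorem IsGoodLabelling.exists_packing (hL : 2 < L) (hm : 0 < m) {n : ℕ}
    (e : Clustered L m r ≃ Fin n) {lab : Clustered L m r × Clustered L m r → Label N}
    (hlab : IsGoodLabelling lab) {D : Digraph (Fin n)}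
    (hD : ∀ u v, u ≠ v → lab (u, v) ≠ none → D.Adj (e u) (e v)) :
    ∃ F : Finset (Set (Fin n × Fin n)), D.IsHamiltonPacking F ∧
      (L - 1) * ((L - 1) * N) ≤ F.card := by
  classical
  choose f hf1 hf2 hf3 using fun (a : {a : ZMod L // a ≠ 0}) (i : CycleIndex L N) =>
    exists_walk hlab a.2 i
  let s : {a : ZMod L // a ≠ 0} × CycleIndex L N → Clustered L m r → Clustered L m r := fun b =>
    walkSucc b.1.1 (f b.1 b.2) (matchings (CycleIndex L N) (extGraph lab b.1.1) b.2)
  let C : {a : ZMod L // a ≠ 0} × CycleIndex L N → Set (Fin n × Fin n) := fun b =>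
    Set.range fun v => (v, e (s b (e.symm v)))
  have hNe : NeZero L := ⟨by omega⟩
  have hnt : Nontrivial (Clustered L m r) := by
    refine ⟨.inl (0, ⟨0, hm⟩), .inl (1, ⟨0, hm⟩), ?_⟩
    simp
  have hne : Nonempty (Fin n) := ⟨e (.inl (0, ⟨0, hm⟩))⟩
  have hdisj : ∀ b b', b ≠ b' → Disjoint (C b) (C b') := by
    intro b b' hb
    rw [Set.disjoint_left]
    rintro _ ⟨v, rfl⟩ ⟨v', hv'⟩
    simp only [Prod.mk.injEq, EmbeddingLike.apply_eq_iff_eq] at hv'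
    obtain ⟨rfl, hv'⟩ := hv'
    have := walk_arc_unique hL hlab b'.1.2 b.1.2 (hf2 _ _) (hf2 _ _) (hf3 _ _) (hf3 _ _) hv'
    exact hb (Prod.ext (Subtype.ext this.1.symm) this.2.symm)
  have hinj : Function.Injective C := by
    intro b b' hb
    by_contra hc
    have := hdisj b b' hc
    rw [← hb, disjoint_self, Set.bot_eq_empty] at this
    exact (Set.range_nonempty _).ne_empty this
  refine ⟨Finset.univ.image C, ⟨?_, ?_⟩, ?_⟩
  · intro c hc
    obtain ⟨b, -, rfl⟩ := Finset.mem_image.1 hc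
    refine ((hf1 b.1 b.2).conj e).isHamiltonCycle fun v => ?_
    have hlabel := walk_label hlab b.1.2 (hf2 b.1 b.2) (hf3 b.1 b.2) (e.symm v)
    have := hD _ _ ((hf1 b.1 b.2).apply_ne (e.symm v)).symm hlabel
    simpa using this
  · intro c hc c' hc' hcc
    obtain ⟨b, -, rfl⟩ := Finset.mem_image.1 hc
    obtain ⟨b', -, rfl⟩ := Finset.mem_image.1 hc'
    exact hdisj b b' fun h => hcc (by rw [h])
  · rw [Finset.card_image_of_injective _ hinj, Finset.card_univ, Fintype.card_prod,
      Fintype.card_prod, Fintype.card_fin, Fintype.card_subtype_compl, Fintype.card_subtype_compl]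
    simp [ZMod.card]

end Assembly

/-! ### Random labellings are good with high probability -/

section RandomLabels

/-- Labels carry the discrete σ-algebra. -/
instance instMeasurableSpaceLabel (N : ℕ) : MeasurableSpace (Label N) := ⊤

instance instDiscreteMeasurableSpaceLabel (N : ℕ) : DiscreteMeasurableSpace (Label N) :=
  ⟨fun _ => trivial⟩

variable {Ω : Type*} [MeasurableSpace Ω] {μ : Measure Ω} {L m r N : ℕ}

lemma isBernoulliFamily_label {β γ : Type*} {Y : β → Ω → Label N} (hYm : ∀ b, Measurable (Y b))
    (hY : iIndepFun Y μ) {l : Label N} {q : ℝ} (hq : ∀ b, μ.real {ω | Y b ω = l} = q)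
    {g : γ → β} (hg : Function.Injective g) :
    IsBernoulliFamily (fun c ω => Y (g c) ω = l) q μ := by
  have h0 : IsBernoulliFamily (fun b ω => Y b ω = l) q μ := by
    have hm : Measurable (fun x : Label N => x = l) := .of_discrete
    exact ⟨fun b => hm.comp (hYm b), hY.comp (fun _ x => x = l) fun _ => hm, hq⟩
  exact h0.precomp hg

lemma slotArc_injective (a k : ZMod L) :
    Function.Injective (slotArc a k : Fin m × Fin m → Clustered L m r × Clustered L m r) := by
  rintro ⟨x, y⟩ ⟨x', y'⟩ h
  simpa [slotArc] using h

lemma extArc_injective (a : ZMod L) :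
    Function.Injective (extArc a : (Fin m ⊕ Fin r) × (Fin m ⊕ Fin r) →
      Clustered L m r × Clustered L m r) := by
  rintro ⟨x, y⟩ ⟨x', y'⟩ h
  simp only [extArc, Prod.mk.injEq] at h
  rw [clusterEmb_injective _ h.1, clusterEmb_injective _ h.2]

/-- The path system does not depend on the labels in the slot in which it is closed. -/
lemma pathPerm_congr [Fact L.Prime] {lab lab' : Clustered L m r × Clustered L m r → Label N}
    {a : ZMod L} (ha : a ≠ 0) (i : CycleIndex L N)
    (h : ∀ b ∉ Set.range (slotArc a i.1.1), lab b = lab' b) :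
    pathPerm lab a i = pathPerm lab' a i := by
  refine slotComp_congr fun j hj => ?_
  have hne := add_one_add_natCast_ne i.1.1 hj
  set k := i.1.1 + 1 + (j : ZMod L)
  unfold slotPerm
  by_cases hk : k = 1
  · simp only [hk, if_true]
    -- Here `k ≠ 1` matters: closing arcs start in the cluster `a * k ≠ a`, whereas the arcs of the
    -- slot with the leftovers start in the cluster `a` or at a leftover.
    have e : extGraph lab a = extGraph lab' a := by
      ext z
      simp only [extGraph]
      rw [h]
      rintro ⟨w, hw⟩
      simp only [slotArc, extArc, Prod.mk.injEq] at hw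
      rcases hz : z.1 with x | j
      · rw [hz] at hw
        simp only [clusterEmb, Sum.inl.injEq, Prod.mk.injEq] at hw
        exact i.1.2 (mul_left_cancel₀ ha (by rw [hw.1.1, mul_one]))
      · rw [hz] at hw
        simp [clusterEmb] at hw
    rw [e]
  · simp only [hk, if_false]
    have e : slotGraph lab a k = slotGraph lab' a k := by
      ext z
      simp only [slotGraph]
      rw [h]
      rintro ⟨w, hw⟩
      simp only [slotArc, Prod.mk.injEq, Sum.inl.injEq] at hw
      exact hne (mul_left_cancel₀ ha hw.1.1.symm)
    rw [e]

variable [IsProbabilityMeasure μ]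

/-- A union bound over L - 1 slots with leftovers, (L - 1)² other slots and (L - 1)²N closings. For
a closing, all labels outside its slot are frozen; this fixes the path bijection, and the labels of
its round inside the slot form a fresh random bipartite graph. -/
theorem measureReal_not_isGoodLabelling [Fact L.Prime] {n : ℕ} {p₁ q ε : ℝ}
    {Y : Clustered L m r × Clustered L m r → Ω → Label N} (hYm : ∀ b, Measurable (Y b))
    (hY : iIndepFun Y μ) (hp₁ : ∀ b, μ.real {ω | Y b ω = some none} = p₁)
    (hq : ∀ b c, μ.real {ω | Y b ω = some (some c)} = q)
    (hp₁0 : 0 ≤ p₁) (hq0 : 0 ≤ q) (hq1 : q ≤ 1) (hε0 : 0 ≤ ε) (hε1 : ε ≤ 1) (hm : 17 ≤ m)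
    (hn : m + r ≤ n) (hqm : 64 * Real.log n ≤ q * m)
    (hpm : 224 * Real.log n ≤ ε ^ 2 * (p₁ * m)) (hr : 4 * r ≤ ε * m)
    (hN : ((L - 1) * N : ℕ) ≤ (1 - ε) * (p₁ * m)) :
    μ.real {ω | ¬ IsGoodLabelling fun b => Y b ω} ≤
      (4 * L ^ 2 + 4 * (L ^ 2 * N)) * ((n : ℝ) ^ 3)⁻¹ := by
  classical
  have hL : 2 ≤ L := (Fact.out : L.Prime).two_le
  have hNe : NeZero L := ⟨by omega⟩
  have hI : Fintype.card (CycleIndex L N) = (L - 1) * N := by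
    rw [Fintype.card_prod, Fintype.card_fin, Fintype.card_subtype_compl]
    simp [ZMod.card]
  let eI : CycleIndex L N ≃ Fin ((L - 1) * N) := Fintype.equivFinOfCardEq hI
  have hfam : ∀ {Z : Type} (A : Z × Z → Prop), (¬ ∃ F : CycleIndex L N → Equiv.Perm Z,
      IsMatchingFamily A F) → ¬ ∃ f : Fin ((L - 1) * N) → Equiv.Perm Z,
      (∀ i x, A (x, f i x)) ∧ ∀ i j x, f i x = f j x → i = j := by
    rintro Z A hA ⟨f, h1, h2⟩
    exact hA ⟨fun i => f (eI i), fun i x => h1 _ x, fun i j x h => eI.injective (h2 _ _ x h)⟩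
  let nz := {a : ZMod L // a ≠ 0}
  let n1 := {a : ZMod L // a ≠ 1}
  have hnz : Fintype.card nz = L - 1 := by
    rw [Fintype.card_subtype_compl]; simp [ZMod.card]
  have hn1 : Fintype.card n1 = L - 1 := by
    rw [Fintype.card_subtype_compl]; simp [ZMod.card]
  let B1 : nz → Set Ω := fun a => {ω | ¬ ∃ F : CycleIndex L N → Equiv.Perm (Fin m ⊕ Fin r),
    IsMatchingFamily (extGraph (fun b => Y b ω) a.1) F}
  let B2 : nz × n1 → Set Ω := fun a => {ω | ¬ ∃ F : CycleIndex L N → Equiv.Perm (Fin m),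
    IsMatchingFamily (slotGraph (fun b => Y b ω) a.1.1 a.2.1) F}
  let B3 : nz × CycleIndex L N → Set Ω := fun a => {ω | ¬ ∃ τ,
    Closes (fun b => Y b ω) a.1.1 a.2 (pathPerm (fun b => Y b ω) a.1.1 a.2) τ}
  have hsub : {ω | ¬ IsGoodLabelling fun b => Y b ω} ⊆
      ((⋃ a ∈ (Finset.univ : Finset nz), B1 a) ∪ ⋃ a ∈ (Finset.univ : Finset (nz × n1)), B2 a) ∪
        ⋃ a ∈ (Finset.univ : Finset (nz × CycleIndex L N)), B3 a := by
    intro ω hω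
    by_contra hc
    simp only [Set.mem_union, Set.mem_iUnion, not_or, not_exists, Finset.mem_univ, forall_true_left]
      at hc
    obtain ⟨⟨c1, c2⟩, c3⟩ := hc
    refine hω ⟨fun a ha => ?_, fun a ha k hk => ?_, fun a ha i => ?_⟩
    · exact not_not.1 (c1 ⟨a, ha⟩)
    · exact not_not.1 (c2 (⟨a, ha⟩, ⟨k, hk⟩))
    · exact not_not.1 (c3 (⟨a, ha⟩, i))
  have b2 : ∀ a ∈ (Finset.univ : Finset (nz × n1)), μ.real (B2 a) ≤ 2 * ((n : ℝ) ^ 3)⁻¹ := by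
    rintro ⟨a, k⟩ -
    have hB := isBernoulliFamily_label hYm hY hp₁ (slotArc_injective (m := m) (r := r) a.1 k.1)
    refine le_trans (measureReal_mono ?_ (measure_ne_top _ _)) (measureReal_not_exists_perms hB hp₁0
      hε0 hε1 (Ex := ∅) (d := 0) (by simp) (by simp) ?_ (n := n) (by omega) (by simp; omega)
      (by simpa using hpm) (r := (L - 1) * N) (by simpa using hN))
    · intro ω hω hc
      refine hfam _ hω ?_
      obtain ⟨f, h1, h2⟩ := hc
      exact ⟨f, fun i x => (h1 i x).2, h2⟩
    · simp; positivity
  have b1 : ∀ a ∈ (Finset.univ : Finset nz), μ.real (B1 a) ≤ 2 * ((n : ℝ) ^ 3)⁻¹ := by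
    rintro a -
    have hB := isBernoulliFamily_label hYm hY hp₁ (extArc_injective (m := m) (r := r) a.1)
    -- Arcs between two leftovers are forbidden. They exclude at most `r` pairs at each vertex,
    -- which `4 * r ≤ ε * m` makes harmless.
    let Ex : Finset ((Fin m ⊕ Fin r) × (Fin m ⊕ Fin r)) :=
      Finset.univ.filter fun z => z.1.isRight ∧ z.2.isRight
    have hcard : (Fintype.card (Fin m ⊕ Fin r) : ℝ) = m + r := by simp
    have hr0 : (0 : ℝ) ≤ r := by positivity
    refine le_trans (measureReal_mono ?_ (measure_ne_top _ _)) (measureReal_not_exists_perms hB hp₁0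
      hε0 hε1 (Ex := Ex) (d := r) ?_ ?_ ?_ (n := n) (by omega) (by simp; omega)
      ?_ (r := (L - 1) * N) ?_)
    · intro ω hω hc
      refine hfam _ hω ?_
      obtain ⟨f, h1, h2⟩ := hc
      refine ⟨f, fun i x => ⟨?_, (h1 i x).2⟩, h2⟩
      simpa [Ex] using (h1 i x).1
    · intro x
      refine le_trans (Finset.card_le_card (t := Finset.univ.image fun j : Fin r => (x, .inr j)) ?_)
        (Finset.card_image_le.trans (by simp))
      rintro ⟨z, w⟩ hz
      simp only [Ex, Finset.mem_filter, Finset.mem_univ, true_and] at hz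
      obtain ⟨j, rfl⟩ := Sum.isRight_iff.1 hz.1.2
      simp [hz.2]
    · intro x
      refine le_trans (Finset.card_le_card (t := Finset.univ.image fun j : Fin r => (.inr j, x)) ?_)
        (Finset.card_image_le.trans (by simp))
      rintro ⟨z, w⟩ hz
      simp only [Ex, Finset.mem_filter, Finset.mem_univ, true_and] at hz
      obtain ⟨j, rfl⟩ := Sum.isRight_iff.1 hz.1.1
      simp [hz.2]
    · rw [hcard]; nlinarith
    · rw [hcard]
      have := mul_nonneg (mul_nonneg (sq_nonneg ε) hp₁0) hr0
      nlinarith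
    · rw [hcard]
      have := mul_nonneg (mul_nonneg (sub_nonneg.2 hε1) hp₁0) hr0
      nlinarith
  have b3 : ∀ a ∈ (Finset.univ : Finset (nz × CycleIndex L N)),
      μ.real (B3 a) ≤ 4 * ((n : ℝ) ^ 3)⁻¹ := by
    rintro ⟨a, i⟩ -
    refine measureReal_decouple_le hYm hY (Set.range (slotArc a.1 i.1.1))
      (fun f g => ¬ ∃ τ, Closes g a.1 i (pathPerm f a.1 i) τ) ?_ ?_
    · intro f f' g g' hf hg hP
      rw [← pathPerm_congr a.2 i hf]
      simp only [Closes] at hP ⊢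
      simpa only [hg _ (Set.mem_range_self _)] using hP
    · intro f
      have hB := isBernoulliFamily_label hYm hY (fun b => hq b i.2)
        (slotArc_injective (m := m) (r := r) a.1 i.1.1)
      exact measureReal_not_exists_cyclic hB hq0 hq1 hm (by omega) hqm (pathPerm f a.1 i)
  have s1 := (measureReal_biUnion_finset_le (μ := μ) Finset.univ B1).trans (Finset.sum_le_sum b1)
  have s2 := (measureReal_biUnion_finset_le (μ := μ) Finset.univ B2).trans (Finset.sum_le_sum b2)
  have s3 := (measureReal_biUnion_finset_le (μ := μ) Finset.univ B3).trans (Finset.sum_le_sum b3)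
  rw [Finset.sum_const, Finset.card_univ, nsmul_eq_mul] at s1 s2 s3
  refine (measureReal_mono hsub (measure_ne_top _ _)).trans ((measureReal_union_le _ _).trans
    ((add_le_add ((measureReal_union_le _ _).trans (add_le_add s1 s2)) s3).trans ?_))
  rw [Fintype.card_prod, Fintype.card_prod, hI, hnz, hn1]
  have hL1 : ((L - 1 : ℕ) : ℝ) ≤ L := by exact_mod_cast Nat.sub_le _ _
  have hL0 : (0 : ℝ) ≤ ((L - 1 : ℕ) : ℝ) := by positivity
  have hL2 : (1 : ℝ) ≤ L := by exact_mod_cast (by omega : 1 ≤ L)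
  have hsq : ((L - 1 : ℕ) : ℝ) * ((L - 1 : ℕ) : ℝ) ≤ L ^ 2 := by nlinarith
  have hN0 : (0 : ℝ) ≤ N := by positivity
  have hx : (0 : ℝ) ≤ ((n : ℝ) ^ 3)⁻¹ := by positivity
  have hcoef : ((L - 1 : ℕ) : ℝ) * 2 + (((L - 1) * (L - 1) : ℕ) : ℝ) * 2 +
      (((L - 1) * ((L - 1) * N) : ℕ) : ℝ) * 4 ≤ 4 * L ^ 2 + 4 * (L ^ 2 * N) := by
    push_cast
    have := mul_le_mul_of_nonneg_right hsq hN0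
    nlinarith
  have := mul_le_mul_of_nonneg_right hcoef hx
  linarith

end RandomLabels

/-! ### The random digraph as the image of a random labelling -/

section Law

variable {N : ℕ}

/-- The weights of the labels of a single arc. -/
noncomputable def labelWeight (p₀ p₁ q : ℝ) : Label N → ENNReal
  | none => ENNReal.ofReal p₀
  | some none => ENNReal.ofReal p₁
  | some (some _) => ENNReal.ofReal q

lemma exists_labelMeasure {p₀ p₁ q : ℝ} (hp₀ : 0 ≤ p₀) (hp₁ : 0 ≤ p₁) (hq : 0 ≤ q)
    (h : p₀ + p₁ + N * q = 1) : ∃ ν : Measure (Label N), IsProbabilityMeasure ν ∧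
      ν.real {none} = p₀ ∧ ν.real {some none} = p₁ ∧ ∀ c, ν.real {some (some c)} = q := by
  have hsum : ∑ l : Label N, labelWeight p₀ p₁ q l = 1 := by
    rw [Fintype.sum_option, Fintype.sum_option]
    simp only [labelWeight, Finset.sum_const, Finset.card_univ, Fintype.card_fin, nsmul_eq_mul]
    rw [← ENNReal.ofReal_natCast, ← ENNReal.ofReal_mul (by positivity), ← ENNReal.ofReal_add hp₁
      (by positivity), ← ENNReal.ofReal_add hp₀ (by positivity), ← add_assoc, h, ENNReal.ofReal_one]
  let P : PMF (Label N) := PMF.ofFintype (labelWeight p₀ p₁ q) hsum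
  have hP : ∀ l, P.toMeasure.real {l} = (labelWeight p₀ p₁ q l).toReal := by
    intro l
    rw [measureReal_def, PMF.toMeasure_apply_singleton _ _ (.of_discrete)]
    rfl
  refine ⟨P.toMeasure, inferInstance, ?_, ?_, fun c => ?_⟩
  · rw [hP]; exact ENNReal.toReal_ofReal hp₀
  · rw [hP]; exact ENNReal.toReal_ofReal hp₁
  · rw [hP]; exact ENNReal.toReal_ofReal hq

/-- Forgetting the labels, one obtains the random digraph. -/
lemma random_eq_map {n : ℕ} (p : unitInterval) (ν : Measure (Label N)) [IsProbabilityMeasure ν]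
    (hν : ν.real {none} = 1 - p) :
    Digraph.random n p = (Measure.pi fun _ : Fin n × Fin n => ν).map
      (fun ω => Digraph.ofArcSet {a | a.1 ≠ a.2 ∧ ω a ≠ none}) := by
  let μ := Measure.pi fun _ : Fin n × Fin n => ν
  let X : Fin n × Fin n → (Fin n × Fin n → Label N) → Prop := fun a ω => a.1 ≠ a.2 ∧ ω a ≠ none
  have hφ : ∀ a : Fin n × Fin n, Measurable (fun l : Label N => a.1 ≠ a.2 ∧ l ≠ none) :=
    fun a => .of_discrete
  have hXm : ∀ a, Measurable (X a) := fun a => (hφ a).comp (measurable_pi_apply a)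
  have hX : iIndepFun X μ :=
    iIndepFun_pi (μ := fun _ : Fin n × Fin n => ν)
      (X := fun (a : Fin n × Fin n) (l : Label N) => a.1 ≠ a.2 ∧ l ≠ none)
      (fun a => (hφ a).aemeasurable)
  -- The marginal law prescribed by `setBernoulli`; on the diagonal both atoms are `False`.
  have hlaw : ∀ a, μ.map (X a) = unitInterval.toNNReal p • Measure.dirac (a ∈ {a : Fin n × Fin n |
      a.1 ≠ a.2}) + unitInterval.toNNReal (unitInterval.symm p) • Measure.dirac False := by
    intro a
    have e : μ.map (X a) = ν.map (fun l : Label N => a.1 ≠ a.2 ∧ l ≠ none) := by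
      have h1 : μ.map (Function.eval a) = ν := (measurePreserving_eval _ a).map_eq
      rw [← h1, Measure.map_map (hφ a) (measurable_pi_apply a)]
      rfl
    rw [e]
    have hnone : ν {none} = (unitInterval.toNNReal (unitInterval.symm p) : ENNReal) := by
      rw [← ENNReal.ofReal_toReal (measure_ne_top ν {none}), ← measureReal_def, hν,
        ENNReal.ofReal]
      congr 1
      ext
      simp [unitInterval.toNNReal, p.2.2]
      rfl
    have hsome : ν {none}ᶜ = (unitInterval.toNNReal p : ENNReal) := by
      rw [← ENNReal.ofReal_toReal (measure_ne_top ν {none}ᶜ), ← measureReal_def,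
        probReal_compl_eq_one_sub .of_discrete, hν, ENNReal.ofReal]
      congr 1
      ext
      simp [unitInterval.toNNReal, p.2.1]
      rfl
    have hone : (unitInterval.toNNReal p : ENNReal) +
        (unitInterval.toNNReal (unitInterval.symm p) : ENNReal) = 1 := by
      rw [← hnone, ← hsome, add_comm, measure_add_measure_compl .of_discrete, measure_univ]
    refine Measure.ext_of_singleton fun b => ?_
    rw [Measure.map_apply (hφ a) .of_discrete]
    simp only [Measure.add_apply, Measure.smul_apply, Measure.dirac_apply]
    by_cases ha : a.1 = a.2
    · by_cases hb : b
      · simp [ha, hb]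
      · simp [ha, hb, hone, ENNReal.smul_def, Set.preimage]
    · by_cases hb : b
      · simp [ha, hb, ENNReal.smul_def, Set.preimage, ← hsome]
        rfl
      · simp [ha, hb, ENNReal.smul_def, Set.preimage, ← hnone]
  rw [Digraph.random, setBernoulli_eq_map]
  have h2 := hX.map_fun_eq_infinitePi_map hXm
  simp only [hlaw] at h2
  rw [← h2, Measure.map_map, Measure.map_map]
  · rfl
  · exact measurable_of_countable _
  · exact measurable_pi_lambda _ hXm
  · exact Digraph.measurable_ofArcSet n
  · exact measurable_of_countable _

theorem le_measureReal_packing {n L m r : ℕ} [Fact L.Prime] (hL : 2 < L) (hn : L * m + r = n)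
    (p : unitInterval) {q ε : ℝ} (hq0 : 0 ≤ q) (hq1 : q ≤ 1) (hNq : N * q ≤ p) (hε0 : 0 ≤ ε)
    (hε1 : ε ≤ 1) (hm : 17 ≤ m) (hqm : 64 * Real.log n ≤ q * m)
    (hpm : 224 * Real.log n ≤ ε ^ 2 * ((p - N * q) * m)) (hr : 4 * r ≤ ε * m)
    (hN : ((L - 1) * N : ℕ) ≤ (1 - ε) * ((p - N * q) * m)) :
    1 - (4 * L ^ 2 + 4 * (L ^ 2 * N)) * ((n : ℝ) ^ 3)⁻¹ ≤ (Digraph.random n p).real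
      {D | ∃ F : Finset (Set (Fin n × Fin n)), D.IsHamiltonPacking F ∧
        (L - 1) * ((L - 1) * N) ≤ F.card} := by
  -- Splitting `p` into `p - N * q` for matching arcs and `q` for each closing round keeps the
  -- probability of presence equal to `p`.
  obtain ⟨ν, hν, h0, h1, h2⟩ := exists_labelMeasure (N := N) (p₀ := 1 - p) (p₁ := p - N * q) (q := q)
    (by linarith [p.2.2]) (by linarith) hq0 (by ring)
  rw [random_eq_map p ν h0]
  let μ := Measure.pi fun _ : Fin n × Fin n => ν
  have hNe : NeZero L := ⟨by omega⟩
  have hcard : Fintype.card (Clustered L m r) = n := by simp [ZMod.card, hn]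
  let e : Clustered L m r ≃ Fin n := Fintype.equivFinOfCardEq hcard
  let Y : Clustered L m r × Clustered L m r → (Fin n × Fin n → Label N) → Label N :=
    fun b ω => ω (e b.1, e b.2)
  have hYm : ∀ b, Measurable (Y b) := fun b => measurable_pi_apply _
  have hid : iIndepFun (fun (a : Fin n × Fin n) (ω : Fin n × Fin n → Label N) => ω a) μ :=
    iIndepFun_pi (μ := fun _ : Fin n × Fin n => ν)
      (X := fun (_ : Fin n × Fin n) (l : Label N) => l) (fun _ => aemeasurable_id)
  have hY : iIndepFun Y μ := by
    refine hid.precomp (g := fun b : Clustered L m r × Clustered L m r => (e b.1, e b.2)) ?_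
    rintro ⟨a, b⟩ ⟨a', b'⟩ h
    simpa using h
  have hprob : ∀ b l, μ.real {ω | Y b ω = l} = ν.real {l} := by
    intro b l
    have h1 : μ.map (Function.eval (e b.1, e b.2)) = ν := (measurePreserving_eval _ _).map_eq
    rw [← h1, map_measureReal_apply (measurable_pi_apply _) .of_discrete]
    rfl
  have hbad := measureReal_not_isGoodLabelling hYm hY (fun b => (hprob b _).trans h1)
    (fun b c => (hprob b _).trans (h2 c)) (by linarith) hq0 hq1 hε0 hε1 hm
    (by nlinarith : m + r ≤ n) hqm hpm hr hN
  rw [map_measureReal_apply (measurable_of_countable _) MeasurableSpace.measurableSet_top]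
  have hmeas : MeasurableSet {ω | IsGoodLabelling fun b => Y b ω} :=
    (Set.toFinite _).measurableSet
  have hc := probReal_compl_eq_one_sub (μ := μ) hmeas
  have hc' : μ.real {ω | ¬ IsGoodLabelling fun b => Y b ω} =
    1 - μ.real {ω | IsGoodLabelling fun b => Y b ω} := hc
  have hle : 1 - (4 * L ^ 2 + 4 * (L ^ 2 * N)) * ((n : ℝ) ^ 3)⁻¹ ≤
    μ.real {ω | IsGoodLabelling fun b => Y b ω} := by linarith
  refine hle.trans (measureReal_mono ?_ (measure_ne_top _ _))
  intro ω hω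
  refine IsGoodLabelling.exists_packing hL (by omega) e hω fun u v huv hlab => ?_
  exact ⟨fun h => huv (e.injective h), hlab⟩

end Law

/-! ### Choice of the parameters -/

section Asymptotics

theorem exists_prime_near {x : ℝ} (hx : 1 ≤ x) :
    ∃ L : ℕ, L.Prime ∧ x ≤ L - 1 ∧ (L : ℝ) ≤ 4 * x := by
  have hx0 : ⌈x⌉₊ ≠ 0 := (Nat.ceil_pos.2 (by linarith)).ne'
  obtain ⟨L, hLp, hLx, hL2x⟩ := Nat.exists_prime_lt_and_le_two_mul ⌈x⌉₊ hx0
  have h1 : x ≤ ⌈x⌉₊ := Nat.le_ceil _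
  have h2 : (⌈x⌉₊ : ℝ) < x + 1 := Nat.ceil_lt_add_one (by linarith)
  have h3 : (⌈x⌉₊ : ℝ) + 1 ≤ L := by exact_mod_cast hLx
  have h4 : (L : ℝ) ≤ 2 * ⌈x⌉₊ := by exact_mod_cast hL2x
  exact ⟨L, hLp, by linarith, by linarith⟩

/-- Quantitative form of the packing theorem. -/
theorem le_measureReal_packing_of_large {n : ℕ} (p : unitInterval) {ε : ℝ} (hε0 : 0 < ε)
    (hε1 : ε ≤ 1 / 4) (hlog : 64 / ε ≤ Real.log n)
    (hp : 1024 / ε * Real.log n ^ 4 ≤ n * p) :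
    1 - ε ≤ (Digraph.random n p).real {D | ∃ F : Finset (Set (Fin n × Fin n)),
      D.IsHamiltonPacking F ∧ (1 - 4 * ε) * (n * p) ≤ (F.card : ℝ)} := by
  obtain ⟨l, hl⟩ : ∃ l, l = Real.log n := ⟨_, rfl⟩
  rw [← hl] at hlog hp
  have hp0 : (0 : ℝ) ≤ p := p.2.1
  have hp1 : (p : ℝ) ≤ 1 := p.2.2
  have hεl : 64 ≤ ε * l := by rw [div_le_iff₀ hε0] at hlog; linarith
  have hl1 : 256 ≤ l := by
    have h : 64 / (1 / 4 : ℝ) ≤ 64 / ε := div_le_div_of_nonneg_left (by norm_num) hε0 hε1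
    linarith
  have hl0 : 0 ≤ l := by linarith
  obtain ⟨s, hs⟩ : ∃ s, s = l * l := ⟨_, rfl⟩
  have hsl : 256 * l ≤ s := hs ▸ mul_le_mul_of_nonneg_right hl1 hl0
  have hs1 : 65536 ≤ s := by linarith
  have hs0 : 0 ≤ s := by linarith
  have hs2 : 65536 * s ≤ s * s := mul_le_mul_of_nonneg_right hs1 hs0
  have hnp : 1024 * (s * s) ≤ ε * (n * p) := by
    rw [div_mul_eq_mul_div, div_le_iff₀ hε0] at hp
    have : l ^ 4 = s * s := by rw [hs]; ring
    rw [this] at hp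
    linarith
  have hn0 : (0 : ℝ) ≤ n := Nat.cast_nonneg n
  have hn : 1024 * (s * s) ≤ ε * n :=
    hnp.trans (mul_le_mul_of_nonneg_left (mul_le_of_le_one_right hn0 hp1) hε0.le)
  have hn' : ε * n ≤ 1 / 4 * n := mul_le_mul_of_nonneg_right hε1 hn0
  -- With `s` = log² n, `L` is large enough for the reserved proportion, at most 64 log n / s, to be
  -- below `ε`, and small enough for L² ≤ 16s² to be below `ε * (n * p)`.
  obtain ⟨L, hLp, hLge, hLle⟩ := exists_prime_near (by linarith : 1 ≤ s)
  have hfact : Fact L.Prime := ⟨hLp⟩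
  have hLpos : (0 : ℝ) < L := by linarith
  have hL3 : 2 < L := by
    have : (2 : ℝ) < L := by linarith
    exact_mod_cast this
  obtain ⟨K, hK⟩ : ∃ K : ℝ, K = L - 1 := ⟨_, rfl⟩
  have hLK : ((L - 1 : ℕ) : ℝ) = K := by
    rw [hK, Nat.cast_sub hLp.one_lt.le, Nat.cast_one]
  have hKs : s ≤ K := by linarith
  have hK0 : 0 < K := by linarith
  obtain ⟨m, hm⟩ : ∃ m, m = n / L := ⟨_, rfl⟩
  obtain ⟨r, hr⟩ : ∃ r, r = n % L := ⟨_, rfl⟩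
  have hnmr : L * m + r = n := by rw [hm, hr]; exact Nat.div_add_mod n L
  have hnmr' : (L : ℝ) * m + r = n := by exact_mod_cast hnmr
  have hrL : (r : ℝ) ≤ L := by rw [hr]; exact_mod_cast (Nat.mod_lt n hLp.pos).le
  have hmn : (m : ℝ) ≤ n := by rw [hm]; exact_mod_cast Nat.div_le_self n L
  clear hm hr
  have hm0 : (0 : ℝ) ≤ m := Nat.cast_nonneg m
  have hr0 : (0 : ℝ) ≤ r := Nat.cast_nonneg r
  have hm8 : (n : ℝ) ≤ 8 * s * m := by
    have := mul_le_mul_of_nonneg_right hLle hm0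
    linarith
  have hεpm : 128 * s ≤ ε * (p * m) := by
    have h0 : ε * (n * p) ≤ ε * (8 * s * m * p) :=
      mul_le_mul_of_nonneg_left (mul_le_mul_of_nonneg_right hm8 hp0) hε0.le
    refine le_of_mul_le_mul_left (a := 8 * s) ?_ (by linarith)
    calc 8 * s * (128 * s) = 1024 * (s * s) := by ring
      _ ≤ ε * (8 * s * m * p) := hnp.trans h0
      _ = 8 * s * (ε * (p * m)) := by ring
  have hpmm : (p : ℝ) * m ≤ m := mul_le_of_le_one_left hm0 hp1
  have hpm0 : (0 : ℝ) ≤ p * m := mul_nonneg hp0 hm0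
  have hεm : 128 * s ≤ ε * m := hεpm.trans (mul_le_mul_of_nonneg_left hpmm hε0.le)
  have hεm' : ε * m ≤ 1 / 4 * m := mul_le_mul_of_nonneg_right hε1 hm0
  have hmpos : (0 : ℝ) < m := by linarith
  have hm17 : 17 ≤ m := by
    have : (17 : ℝ) ≤ m := by linarith
    exact_mod_cast this
  -- The least density for which the closing argument applies.
  obtain ⟨q, hq⟩ : ∃ q : ℝ, q = 64 * l / m := ⟨_, rfl⟩
  have hqm : q * m = 64 * l := by rw [hq]; field_simp
  have hq0 : 0 ≤ q := by rw [hq]; positivity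
  have hq1 : q ≤ 1 := by rw [hq, div_le_one hmpos]; linarith
  -- One factor 1 - ε pays for the reserved arcs and one for the packing of matchings; 1 - 2ε ≤ (1 -
  -- ε)² covers both.
  obtain ⟨N, hN⟩ : ∃ N, N = ⌊(1 - 2 * ε) * (p * m) / K⌋₊ := ⟨_, rfl⟩
  have hN1 : K * N ≤ (1 - 2 * ε) * (p * m) := by
    have h1 : (N : ℝ) ≤ (1 - 2 * ε) * (p * m) / K :=
      hN ▸ Nat.floor_le (div_nonneg (mul_nonneg (by linarith) hpm0) hK0.le)
    rw [le_div_iff₀ hK0] at h1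
    linarith
  have hN2 : (1 - 2 * ε) * (p * m) - K ≤ K * N := by
    have h1 : (1 - 2 * ε) * (p * m) / K < (N : ℝ) + 1 := hN ▸ Nat.lt_floor_add_one _
    rw [div_lt_iff₀ hK0] at h1
    linarith
  clear hN
  have hN0 : (0 : ℝ) ≤ N := Nat.cast_nonneg N
  have hNp : K * N ≤ p * m := hN1.trans (mul_le_of_le_one_left hpm0 (by linarith))
  have hNq : N * q ≤ ε * p := by
    have h1 : s * N ≤ p * m := (mul_le_mul_of_nonneg_right hKs hN0).trans hNp
    have h2 : (m * s) * (N * q) ≤ (m * s) * (ε * p) := by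
      calc (m * s) * (N * q) = (s * N) * (q * m) := by ring
        _ ≤ (p * m) * (q * m) := mul_le_mul_of_nonneg_right h1 (mul_nonneg hq0 hm0)
        _ = (p * m) * (64 * l) := by rw [hqm]
        _ ≤ (p * m) * (ε * l * l) :=
            mul_le_mul_of_nonneg_left (mul_le_mul_of_nonneg_right hεl hl0) hpm0
        _ = (m * s) * (ε * p) := by rw [hs]; ring
    exact le_of_mul_le_mul_left h2 (mul_pos hmpos (by linarith))
  obtain ⟨P, hP⟩ : ∃ P : ℝ, P = (p - N * q) * m := ⟨_, rfl⟩
  have hPm : (1 - ε) * (p * m) ≤ P := by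
    have := mul_le_mul_of_nonneg_right hNq hm0
    rw [hP]
    linarith
  have main := le_measureReal_packing (N := N) hL3 hnmr p hq0 hq1
    (hNq.trans (mul_le_of_le_one_left hp0 (by linarith))) hε0.le
    (by linarith) hm17 (by rw [← hl]; exact hqm.ge) ?_ (by linarith) ?_
  rotate_left
  · rw [← hl, ← hP]
    have h1 : ε * (3 / 4 * (p * m)) ≤ ε * P := by
      refine mul_le_mul_of_nonneg_left (le_trans ?_ hPm) hε0.le
      exact mul_le_mul_of_nonneg_right (by linarith) hpm0
    have h2 : ε * (96 * s) ≤ ε * (ε * P) := mul_le_mul_of_nonneg_left (by linarith) hε0.le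
    have h3 : 64 * l ≤ ε * s := by
      have := mul_le_mul_of_nonneg_right hεl hl0
      rwa [mul_assoc, ← hs] at this
    calc 224 * l ≤ ε * (96 * s) := by linarith
      _ ≤ ε * (ε * P) := h2
      _ = ε ^ 2 * P := by ring
  · rw [← hP, Nat.cast_mul, hLK]
    have h1 : (1 - ε) * ((1 - ε) * (p * m)) ≤ (1 - ε) * P :=
      mul_le_mul_of_nonneg_left hPm (by linarith)
    have h2 := mul_nonneg (sq_nonneg ε) hpm0
    linarith
  have hL16 : (L : ℝ) * L ≤ 16 * (s * s) :=
    (mul_le_mul hLle hLle hLpos.le (by linarith)).trans_eq (by ring)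
  have hfail : (4 * L ^ 2 + 4 * (L ^ 2 * N)) * ((n : ℝ) ^ 3)⁻¹ ≤ ε := by
    have hNn : (N : ℝ) ≤ n := by
      have h1 : (N : ℝ) ≤ K * N := le_mul_of_one_le_left hN0 (by linarith)
      linarith
    have hnpos : (0 : ℝ) < n := by linarith
    rw [← div_eq_mul_inv, div_le_iff₀ (by positivity)]
    calc (4 * (L : ℝ) ^ 2 + 4 * (L ^ 2 * N)) = 4 * (L * L) * (1 + N) := by ring
      _ ≤ ε * n * (n + n) :=
          mul_le_mul (by linarith) (by linarith) (by positivity) (by positivity)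
      _ = 2 * (ε * n ^ 2) := by ring
      _ ≤ n * (ε * n ^ 2) := mul_le_mul_of_nonneg_right (by linarith) (by positivity)
      _ = ε * n ^ 3 := by ring
  refine le_trans (by linarith) (main.trans (measureReal_mono ?_ (measure_ne_top _ _)))
  rintro D ⟨F, hF, hcard⟩
  refine ⟨F, hF, ?_⟩
  have hcard' : K * (K * N) ≤ F.card := by rw [← hLK]; exact_mod_cast hcard
  refine le_trans ?_ ((mul_le_mul_of_nonneg_left hN2 hK0.le).trans hcard')
  -- Rounding `N` down costs at most `K * K` cycles in total, and the lower bound on `n * p` of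
  -- order log⁴ n / ε absorbs them.
  have hKK : K * K ≤ ε * (n * p) := by
    have : K * K ≤ L * L := mul_le_mul (by linarith) (by linarith) hK0.le hLpos.le
    linarith [mul_nonneg hs0 hs0]
  have hKm : (1 - ε) * n ≤ K * m := by
    have h1 : ε * s ≤ ε * L := mul_le_mul_of_nonneg_left (by linarith) hε0.le
    have h2 : 2 ≤ ε * s := by
      have := mul_le_mul_of_nonneg_left hsl hε0.le
      linarith
    have h3 : 2 * (m : ℝ) ≤ ε * (L * m) :=
      (mul_le_mul_of_nonneg_right (h2.trans h1) hm0).trans_eq (mul_assoc _ _ _)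
    have h4 : ε * (L * m) ≤ ε * n := mul_le_mul_of_nonneg_left (by linarith) hε0.le
    rw [hK]
    linarith
  have hmain : (1 - 2 * ε) * ((1 - ε) * n * p) ≤ (1 - 2 * ε) * (K * m * p) :=
    mul_le_mul_of_nonneg_left (mul_le_mul_of_nonneg_right hKm hp0) (by linarith)
  -- The final count uses (1 - 2ε)(1 - ε) - ε = 1 - 4ε + 2ε².
  have hsq : (0 : ℝ) ≤ ε ^ 2 * (n * p) := by positivity
  linarith

end Asymptotics

end HamiltonPacking

theorem theorem1p1 (p : ℕ → unitInterval)
    (hp : (fun n : ℕ => Real.log (n : ℝ) ^ 4 / (n : ℝ)) =o[Filter.atTop]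
      (fun n : ℕ => (p n : ℝ))) :
    ∃ ε : ℕ → ℝ, Filter.Tendsto ε Filter.atTop (nhds 0) ∧
      Filter.Tendsto
        (fun n : ℕ => (Digraph.random n (p n)).real
          {D | ∃ F : Finset (Set (Fin n × Fin n)),
            D.IsHamiltonPacking F ∧ (1 - ε n) * ((n : ℝ) * (p n : ℝ)) ≤ (F.card : ℝ)})
        Filter.atTop (nhds 1) := by
  -- Each summand secures one of the two lower bounds, on log n and on np, required by
  -- `le_measureReal_packing_of_large`.
  let δ : ℕ → ℝ := fun n =>
    64 / Real.log n + 1024 * (Real.log (n : ℝ) ^ 4 / (n : ℝ) / (p n : ℝ))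
  have hlog : Filter.Tendsto (fun n : ℕ => Real.log (n : ℝ)) Filter.atTop Filter.atTop :=
    Real.tendsto_log_atTop.comp tendsto_natCast_atTop_atTop
  have hδ : Filter.Tendsto δ Filter.atTop (nhds 0) := by
    have h1 := (hlog.const_div_atTop 64).add (hp.tendsto_div_nhds_zero.const_mul 1024)
    simpa using h1
  refine ⟨fun n => 4 * δ n, by simpa using hδ.const_mul 4, ?_⟩
  have hlow : Filter.Tendsto (fun n => 1 - δ n) Filter.atTop (nhds 1) := by
    simpa using hδ.const_sub 1
  refine tendsto_of_tendsto_of_tendsto_of_le_of_le' hlow tendsto_const_nhds ?_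
    (Filter.Eventually.of_forall fun n => MeasureTheory.measureReal_le_one)
  have hev := hp.bound (show (0 : ℝ) < 1 by norm_num)
  filter_upwards [hδ.eventually (ge_mem_nhds (show (0 : ℝ) < 1 / 4 by norm_num)),
    hlog.eventually_gt_atTop 0, hev, Filter.eventually_gt_atTop 0] with n h1 h2 h3 h4
  have hn : (0 : ℝ) < n := by exact_mod_cast h4
  have hp0 : 0 < (p n : ℝ) := by
    rw [one_mul, Real.norm_of_nonneg (by positivity), Real.norm_of_nonneg (p n).2.1] at h3
    exact lt_of_lt_of_le (by positivity) h3
  have ha : 0 < 64 / Real.log n := by positivity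
  have hb : 0 < 1024 * (Real.log (n : ℝ) ^ 4 / (n : ℝ) / (p n : ℝ)) := by positivity
  have hδ0 : 0 < δ n := add_pos ha hb
  refine HamiltonPacking.le_measureReal_packing_of_large (p n) hδ0 h1 ?_ ?_
  · rw [div_le_iff₀ hδ0]
    have : 64 / Real.log n ≤ δ n := by simp only [δ]; linarith
    rw [div_le_iff₀ h2] at this
    linarith
  · have : 1024 * (Real.log (n : ℝ) ^ 4 / (n : ℝ) / (p n : ℝ)) ≤ δ n := by simp only [δ]; linarith
    rw [div_mul_eq_mul_div, div_le_iff₀ hδ0]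
    have e : 1024 * Real.log (n : ℝ) ^ 4 =
        1024 * (Real.log (n : ℝ) ^ 4 / (n : ℝ) / (p n : ℝ)) * (n * p n) := by field_simp
    rw [e, mul_comm ((n : ℝ) * p n)]
    exact mul_le_mul_of_nonneg_right this (by positivity)
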